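/- Theorem 4.1. Let $G$ be a (finite-dimensional, real, second countable) Lie group with Lie algebra $\mathfrak g$, acting smoothly and transitively from the left on a smooth manifold $M$ (so that $M\cong G/H$ is a homogeneous space, with $H=G_{m_0}$ the isotropy group of some $m_0\in M$). For $\xi\in\mathfrak g$ let $\xi_M(m)=\frac{d}{dt}\big|_{t=0}\exp(t\xi)\cdot m$ be the infinitesimal generator of the action, let $\operatorname{ad}^*_\xi:\mathfrak g^*\to\mathfrak g^*$, $\langle \operatorname{ad}^*_\xi\mu,\eta\rangle=\langle\mu,[\xi,\eta]\rangle$ (where $[\cdot,\cdot]$ is the bracket of left invariant vector fields), and let $\mathbf J:T^*M\to\mathfrak g^*$, $\langle\mathbf J(\alpha_m),\zeta\rangle=\langle\alpha_m,\zeta_M(m)\rangle$. Let $\mathfrak L:TM\to\mathbb R$ be a smooth Lagrangian and define $l:\mathfrak g\times M\to\mathbb R$ by $l(\xi,m)=\mathfrak L(m,\xi_M(m))$; write $\frac{\delta l}{\delta\xi}(\xi,m)\in\mathfrak g^*$ and $\frac{\delta l}{\delta m}(\xi,m)\in T_m^*M$ for its partial differentials. Let $t_0<t_1$ and let $m:[t_0,t_1]\to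 M$ be a smooth curve. Then the following are equivalent. (i) $m$ is a solution of the Euler–Lagrange equations for $\mathfrak L$, i.e. in all local coordinates of $M$ $$\frac{\partial\mathfrak L}{\partial m}-\frac{d}{dt}\frac{\partial\mathfrak L}{\partial\dot m}=0 .$$ (ii) $m$ is a solution of the Euler–Poincaré equations for $l$, i.e. there is a smooth curve $\xi:[t_0,t_1]\to\mathfrak g$ such that on $[t_0,t_1]$ $$\frac{d}{dt}\frac{\delta l}{\delta\xi}+\operatorname{ad}^*_\xi\frac{\delta l}{\delta\xi}=\mathbf J\!\left(\frac{\delta l}{\delta m}\right),\qquad \dot m=\xi_M(m).$$ (iii) For every smooth curve $\xi:[t_0,t_1]\to\mathfrak g$ with $\dot m=\xi_M(m)$ on $[t_0,t_1]$, the equation $\frac{d}{dt}\frac{\delta l}{\delta\xi}+\operatorname{ad}^*_\xi\frac{\delta l}{\delta\xi}=\mathbf J\!\left(\frac{\delta l}{\delta m}\right)$ holds on $[t_0,t_1]$. -/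

import Mathlib

open Set
open scoped Manifold ContDiff Topology

noncomputable section

namespace EulerPoincare

variable {E : Type*} [NormedAddCommGroup E] [NormedSpace ℝ E]
  {F : Type*} [NormedAddCommGroup F] [NormedSpace ℝ F]
  {G : Type*} [TopologicalSpace G] [ChartedSpace E G] [Group G]
  {M : Type*} [TopologicalSpace M] [ChartedSpace F M]

/-- A smooth Lie group has the (finite) smoothness under which Mathlib provides the Lie algebra
structure on its tangent space at the identity. -/
instance lieGroup_minSmoothness [LieGroup 𝓘(ℝ, E) ∞ G] :
    LieGroup 𝓘(ℝ, E) (minSmoothness ℝ 3) G := by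
  rw [minSmoothness_of_isRCLikeNormedField]
  infer_instance

instance finiteDimensional_groupLieAlgebra [FiniteDimensional ℝ E] :
    FiniteDimensional ℝ (GroupLieAlgebra 𝓘(ℝ, E) G) :=
  inferInstanceAs (FiniteDimensional ℝ E)

instance t2Space_groupLieAlgebra : T2Space (GroupLieAlgebra 𝓘(ℝ, E) G) :=
  inferInstanceAs (T2Space E)

/-! ### Euler-Lagrange equations -/

/-- The Lagrangian `L : TM → ℝ` in the coordinates `(x, v)` on `TM` induced by a chart `e` of `M`:
`L (e⁻¹ x, T_x e⁻¹ v)`. -/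
def chartLagrangian (L : TangentBundle 𝓘(ℝ, F) M → ℝ) (e : OpenPartialHomeomorph M F)
    (x v : F) : ℝ :=
  L ⟨e.symm x, mfderiv 𝓘(ℝ, F) 𝓘(ℝ, F) e.symm x v⟩

/-- The curve `m` satisfies the Euler-Lagrange equations `∂L/∂m - d/dt ∂L/∂ṁ = 0` on `[t₀, t₁]`:
in every chart of `M`, at every time at which the curve lies in the domain of the chart.
Derivatives in time are one-sided at the end points. -/
def IsEulerLagrangeSolution (L : TangentBundle 𝓘(ℝ, F) M → ℝ) (t₀ t₁ : ℝ) (m : ℝ → M) : Prop :=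
  ∀ e ∈ IsManifold.maximalAtlas 𝓘(ℝ, F) ∞ M, ∀ t ∈ Icc t₀ t₁, m t ∈ e.source →
    fderiv ℝ (fun x : F => chartLagrangian L e x (derivWithin (e ∘ m) (Icc t₀ t₁) t)) (e (m t))
      - derivWithin
          (fun s => fderiv ℝ (fun v : F => chartLagrangian L e (e (m s)) v)
            (derivWithin (e ∘ m) (Icc t₀ t₁) s))
          (Icc t₀ t₁) t = 0

/-! ### Euler-Poincaré equations -/

section Action

variable [MulAction G M]

/-- The linear map `𝔤 → T_m M`, `ξ ↦ ξ_M(m)`: the derivative at `1` of the orbit map `g ↦ g • m`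
(note `1 • m = m`). -/
def generatorMap (m : M) : GroupLieAlgebra 𝓘(ℝ, E) G →L[ℝ] TangentSpace 𝓘(ℝ, F) m :=
  (mfderiv 𝓘(ℝ, E) 𝓘(ℝ, F) (fun g : G => g • m) (1 : G) : E →L[ℝ] F)

/-- The value `ξ_M(m)` at `m` of the infinitesimal generator vector field of `ξ`, that is, the
velocity at time `0` of `t ↦ exp(tξ) • m` (see `velocity_smul_eq_generator`). -/
def generator (ξ : GroupLieAlgebra 𝓘(ℝ, E) G) (m : M) : TangentSpace 𝓘(ℝ, F) m :=
  generatorMap m ξ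

/-- `ξ_M(m)` is the velocity at time `0` of `γ(t) • m` for every curve `γ` in `G` with `γ(0) = 1`
and `γ'(0) = ξ`, in particular for the one-parameter subgroup `γ(t) = exp(tξ)`. -/
theorem velocity_smul_eq_generator [ContMDiffSMul 𝓘(ℝ, E) 𝓘(ℝ, F) ∞ G M]
    {γ : ℝ → G} (h0 : γ 0 = 1) (hγ : MDifferentiableAt 𝓘(ℝ, ℝ) 𝓘(ℝ, E) γ 0)
    (ξ : GroupLieAlgebra 𝓘(ℝ, E) G)
    (hξ : (mfderiv 𝓘(ℝ, ℝ) 𝓘(ℝ, E) γ 0 (1 : ℝ) : E) = ξ) (m : M) :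
    (mfderiv 𝓘(ℝ, ℝ) 𝓘(ℝ, F) (fun t => γ t • m) (0 : ℝ) (1 : ℝ) : F) = generator ξ m := by
  have hs : ContMDiff 𝓘(ℝ, E) 𝓘(ℝ, F) ∞ (fun g : G => g • m) :=
    (ContMDiffSMul.contMDiff_smul (I := 𝓘(ℝ, E)) (I' := 𝓘(ℝ, F)) (n := ∞) (G := G) (M := M)).comp
      (contMDiff_id.prodMk contMDiff_const)
  have hd : MDifferentiableAt 𝓘(ℝ, E) 𝓘(ℝ, F) (fun g : G => g • m) (γ 0) :=
    (hs (γ 0)).mdifferentiableAt (by simp)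
  have := (hd.hasMFDerivAt.comp (0 : ℝ) hγ.hasMFDerivAt).mfderiv
  change (mfderiv 𝓘(ℝ, ℝ) 𝓘(ℝ, F) ((fun g : G => g • m) ∘ γ) (0 : ℝ) (1 : ℝ) : F) = _
  rw [this, ← hξ, h0]
  rfl

/-- The momentum map `J : T*M → 𝔤*` of the cotangent lifted action, on the fibre over `m`:
`⟨J(α), ζ⟩ = ⟨α, ζ_M(m)⟩`. -/
def momentumMap (m : M) (α : TangentSpace 𝓘(ℝ, F) m →L[ℝ] ℝ) :
    GroupLieAlgebra 𝓘(ℝ, E) G →L[ℝ] ℝ :=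
  α.comp (generatorMap m)

/-- The reduced Lagrangian `l : 𝔤 × M → ℝ`, `l(ξ, m) = L(m, ξ_M(m))`. -/
def reducedLagrangian (L : TangentBundle 𝓘(ℝ, F) M → ℝ)
    (ξ : GroupLieAlgebra 𝓘(ℝ, E) G) (m : M) : ℝ :=
  L ⟨m, generator ξ m⟩

end Action

/-- The infinitesimal coadjoint operator `ad*_ξ : 𝔤* → 𝔤*`, the dual of `ad_ξ`:
`⟨ad*_ξ μ, η⟩ = ⟨μ, [ξ, η]⟩`. -/
def coadjoint [FiniteDimensional ℝ E] [LieGroup 𝓘(ℝ, E) ∞ G]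
    (ξ : GroupLieAlgebra 𝓘(ℝ, E) G) (μ : GroupLieAlgebra 𝓘(ℝ, E) G →L[ℝ] ℝ) :
    GroupLieAlgebra 𝓘(ℝ, E) G →L[ℝ] ℝ :=
  μ.comp (LinearMap.toContinuousLinearMap (LieAlgebra.ad ℝ (GroupLieAlgebra 𝓘(ℝ, E) G) ξ))

/-- The functional derivative `δl/δξ ∈ 𝔤*` at `(ξ, m)`: the derivative of `l(·, m)` at `ξ`. -/
def deltaXi (l : GroupLieAlgebra 𝓘(ℝ, E) G → M → ℝ) (ξ : GroupLieAlgebra 𝓘(ℝ, E) G) (m : M) :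
    GroupLieAlgebra 𝓘(ℝ, E) G →L[ℝ] ℝ :=
  fderiv ℝ (fun ζ => l ζ m) ξ

/-- The functional derivative `δl/δm ∈ T*_m M` at `(ξ, m)`: the differential of `l(ξ, ·)` at `m`. -/
def deltaM (l : GroupLieAlgebra 𝓘(ℝ, E) G → M → ℝ) (ξ : GroupLieAlgebra 𝓘(ℝ, E) G) (m : M) :
    TangentSpace 𝓘(ℝ, F) m →L[ℝ] ℝ :=
  mfderiv 𝓘(ℝ, F) 𝓘(ℝ, ℝ) (fun p : M => l ξ p) m

/-- The equation `d/dt δl/δξ + ad*_ξ δl/δξ = J(δl/δm)` in `𝔤*` along `(ξ(t), m(t))`,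
for `t ∈ [t₀, t₁]`. -/
def SatisfiesEulerPoincare [MulAction G M] [FiniteDimensional ℝ E] [LieGroup 𝓘(ℝ, E) ∞ G]
    (l : GroupLieAlgebra 𝓘(ℝ, E) G → M → ℝ) (t₀ t₁ : ℝ)
    (ξ : ℝ → GroupLieAlgebra 𝓘(ℝ, E) G) (m : ℝ → M) : Prop :=
  ∀ t ∈ Icc t₀ t₁,
    derivWithin (fun s => deltaXi l (ξ s) (m s)) (Icc t₀ t₁) t
        + coadjoint (ξ t) (deltaXi l (ξ t) (m t))
      = momentumMap (m t) (deltaM (F := F) l (ξ t) (m t))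

/-- The equation `ṁ = ξ_M(m)` on `[t₀, t₁]`. -/
def IsReconstruction [MulAction G M] (t₀ t₁ : ℝ)
    (ξ : ℝ → GroupLieAlgebra 𝓘(ℝ, E) G) (m : ℝ → M) : Prop :=
  ∀ t ∈ Icc t₀ t₁,
    mfderivWithin 𝓘(ℝ, ℝ) 𝓘(ℝ, F) m (Icc t₀ t₁) t (1 : ℝ) = generator (ξ t) (m t)

/-- Smoothness on `[t₀, t₁]` of a curve in the Lie algebra `𝔤`, which as a vector space is the
model space `E`. -/
def IsSmoothLieAlgebraCurve (t₀ t₁ : ℝ) (ξ : ℝ → GroupLieAlgebra 𝓘(ℝ, E) G) : Prop :=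
  ContDiffOn ℝ ∞ (F := E) ξ (Icc t₀ t₁)

end EulerPoincare

end

/-! In a chart, let `y` be the coordinate, `Λ(y, v)` the Lagrangian and `a(y) : 𝔤 → F` the linear
map sending `ζ` to its generator. Then `l(ζ, y) = Λ(y, a(y) ζ)`. Along a curve with `ẏ = a(y) ξ` put
`p = ∂Λ/∂v`, so that `δl/δξ = p ∘ a(y)`. Pairing the Euler–Poincaré expression with `η` gives `ṗ(aη)
+ p(Da(aξ) η) + p(a[ξ, η]) - ∂Λ/∂y(aη) - p(Da(aη) ξ)`. Generators of a left action form an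
antihomomorphism, `a[ξ, η] = Da(aη) ξ - Da(aξ) η` (`fderiv_chartGenerator_sub`), so what remains is
minus the Euler–Lagrange covector evaluated on `aη` (`eulerPoincare_apply_eq_neg_eulerLagrange`).

Transitivity enters through surjectivity of `a(y)` (`surjective_chartGenerator`). The orbit map is
open by a Baire category argument and has constant rank by equivariance. An open map of constant
rank is a submersion, since otherwise its local image would have too small a Hausdorff dimension.

Surjectivity makes vanishing on all generators the same as vanishing. It also yields a smooth `ξ`
with `ṁ = ξ_M(m)` (`exists_isReconstruction`): this linear equation is solved smoothly near each
time, and the local solutions are averaged by a partition of unity, the solution sets being affine.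
For every such `ξ` the two systems are equivalent, and one such `ξ` exists, so the "some" and
"every" forms both agree with Euler–Lagrange. -/

noncomputable section

namespace EulerPoincare

/-! ### Calculus in vector spaces: open maps of maximal rank, brackets of generators, variations -/

section Calculus

variable {E : Type*} [NormedAddCommGroup E] [NormedSpace ℝ E]
  {F : Type*} [NormedAddCommGroup F] [NormedSpace ℝ F]

/-- A map between finite-dimensional spaces that is open at `x₀` and whose rank is maximal
at `x₀` is a submersion at `x₀`. -/
theorem surjective_fderiv_of_nhds_le_map [FiniteDimensional ℝ E] [FiniteDimensional ℝ F]
    {f : E → F} {x₀ : E} (hf : ContDiffAt ℝ 1 f x₀)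
    (hr : ∀ᶠ x in 𝓝 x₀, Module.finrank ℝ (fderiv ℝ f x).range
      ≤ Module.finrank ℝ (fderiv ℝ f x₀).range)
    (ho : 𝓝 (f x₀) ≤ Filter.map f (𝓝 x₀)) :
    Function.Surjective (fderiv ℝ f x₀) := by
  set A := fderiv ℝ f x₀ with hA
  obtain ⟨P₀, hP₀⟩ := Submodule.exists_isCompl A.range
  let P : F →L[ℝ] A.range :=
    LinearMap.toContinuousLinearMap (Submodule.projectionOnto A.range P₀ hP₀)
  have hP : ∀ r : A.range, P r = r := fun r =>
    Submodule.projectionOnto_apply_left hP₀ r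
  obtain ⟨Q₀, hQ₀⟩ := Submodule.exists_isCompl A.ker
  let Q : E →L[ℝ] A.ker :=
    LinearMap.toContinuousLinearMap (Submodule.projectionOnto A.ker Q₀ hQ₀)
  have hQ : ∀ r : A.ker, Q r = r := fun r =>
    Submodule.projectionOnto_apply_left hQ₀ r
  -- Rank theorem coordinates: `Φ` has invertible derivative at `x₀`, and in these coordinates `f`
  -- becomes `h` with `P (h y) = y.1`.
  let Φ : E → A.range × A.ker := fun x => (P (f x), Q x)
  let D : E →L[ℝ] A.range × A.ker := (P.comp A).prod Q
  have hDinj : Function.Injective D := by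
    rw [injective_iff_map_eq_zero]
    intro x hx
    have h1 : P (A x) = 0 := congrArg Prod.fst hx
    have h2 : Q x = 0 := congrArg Prod.snd hx
    have h3 : A x = 0 := by
      have := hP ⟨A x, x, rfl⟩
      rw [show P ((⟨A x, x, rfl⟩ : A.range) : F) = P (A x) from rfl, h1] at this
      exact (congrArg Subtype.val this).symm
    have := hQ ⟨x, h3⟩
    rw [show Q ((⟨x, h3⟩ : A.ker) : E) = Q x from rfl, h2] at this
    exact (congrArg Subtype.val this).symm
  have hdim : Module.finrank ℝ E = Module.finrank ℝ (A.range × A.ker) := by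
    rw [Module.finrank_prod]
    exact (LinearMap.finrank_range_add_finrank_ker (A : E →ₗ[ℝ] F)).symm
  let D' : E ≃L[ℝ] A.range × A.ker :=
    (LinearEquiv.ofInjectiveOfFinrankEq (D : E →ₗ[ℝ] _) hDinj hdim).toContinuousLinearEquiv
  have hΦ : ContDiffAt ℝ 1 Φ x₀ :=
    (P.contDiff.contDiffAt.comp x₀ hf).prodMk Q.contDiff.contDiffAt
  have hΦ' : HasFDerivAt Φ (D' : E →L[ℝ] A.range × A.ker) x₀ := by
    have h1 : HasFDerivAt f A x₀ := (hf.differentiableAt (by simp)).hasFDerivAt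
    have : HasFDerivAt Φ D x₀ := (P.hasFDerivAt.comp x₀ h1).prodMk Q.hasFDerivAt
    exact this
  set y₀ := Φ x₀ with hy₀
  let e := hΦ.toOpenPartialHomeomorph Φ hΦ' (by simp)
  have hex : x₀ ∈ e.source := hΦ.mem_toOpenPartialHomeomorph_source hΦ' (by simp)
  have he : ∀ x, e x = Φ x := fun x => rfl
  have hψ : ContDiffAt ℝ 1 e.symm y₀ := hΦ.to_localInverse hΦ' (by simp)
  have hψy : e.symm y₀ = x₀ := e.left_inv hex
  let h : A.range × A.ker → F := fun y => f (e.symm y)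
  have hy₀t : y₀ ∈ e.target := e.map_source hex
  have ev : ∀ᶠ y in 𝓝 y₀, y ∈ e.target ∧ ContDiffAt ℝ 1 e.symm y ∧
      ContDiffAt ℝ 1 f (e.symm y) ∧ Module.finrank ℝ (fderiv ℝ f (e.symm y)).range
      ≤ Module.finrank ℝ A.range := by
    have hc : Filter.Tendsto e.symm (𝓝 y₀) (𝓝 x₀) := by
      have := hψ.continuousAt.tendsto
      rwa [hψy] at this
    exact (show ∀ᶠ y in 𝓝 y₀, y ∈ e.target from e.open_target.mem_nhds hy₀t).and ((hψ.eventually (by simp)).and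
      ((hc.eventually (hf.eventually (by simp))).and (hc.eventually hr)))
  obtain ⟨ε, hε, hball⟩ := Metric.eventually_nhds_iff_ball.1 ev
  have hprod : Metric.ball y₀ ε = Metric.ball y₀.1 ε ×ˢ Metric.ball y₀.2 ε :=
    (ball_prod_same _ _ _).symm
  have hPh : ∀ y ∈ Metric.ball y₀ ε, P (h y) = y.1 := fun y hy =>
    congrArg Prod.fst (e.right_inv (hball y hy).1)
  have hhC : ∀ y ∈ Metric.ball y₀ ε, ContDiffAt ℝ 1 h y := fun y hy =>
    (hball y hy).2.2.1.comp y (hball y hy).2.1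
  -- `P` maps the range of `Dh(y)` onto `A.range`. By the rank bound it is then injective there, and
  -- it kills `Dh(y)(0, k)`.
  have hzero : ∀ y ∈ Metric.ball y₀ ε, ∀ k : A.ker, fderiv ℝ h y (0, k) = 0 := by
    intro y hy k
    have hd : HasFDerivAt h (fderiv ℝ h y) y :=
      ((hhC y hy).differentiableAt (by simp)).hasFDerivAt
    have hfst : P.comp (fderiv ℝ h y) = ContinuousLinearMap.fst ℝ A.range A.ker := by
      have h1 : HasFDerivAt (fun y => P (h y)) (P.comp (fderiv ℝ h y)) y :=
        P.hasFDerivAt.comp y hd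
      have h2 : HasFDerivAt (fun y => P (h y)) (ContinuousLinearMap.fst ℝ A.range A.ker) y :=
        hasFDerivAt_fst.congr_of_eventuallyEq
          (Filter.mem_of_superset (Metric.isOpen_ball.mem_nhds hy) hPh)
      exact h1.unique h2
    have hrange : (fderiv ℝ h y).range ≤ (fderiv ℝ f (e.symm y)).range := by
      have : fderiv ℝ h y = (fderiv ℝ f (e.symm y)).comp (fderiv ℝ e.symm y) :=
        fderiv_comp y ((hball y hy).2.2.1.differentiableAt (by simp))
          ((hball y hy).2.1.differentiableAt (by simp))
      rw [this]
      rintro _ ⟨x, rfl⟩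
      exact ⟨_, rfl⟩
    have hfin : Module.finrank ℝ (fderiv ℝ h y).range ≤ Module.finrank ℝ A.range :=
      (Submodule.finrank_mono hrange).trans (hball y hy).2.2.2
    let P' : (fderiv ℝ h y).range →ₗ[ℝ] A.range := (P : F →ₗ[ℝ] A.range).domRestrict _
    have hsurj : Function.Surjective P' := by
      intro r
      refine ⟨⟨fderiv ℝ h y (r, 0), _, rfl⟩, ?_⟩
      exact DFunLike.congr_fun hfst (r, 0)
    have hinj : Function.Injective P' :=
      (LinearMap.injective_iff_surjective_of_finrank_eq_finrank
        (le_antisymm hfin (LinearMap.finrank_le_finrank_of_surjective hsurj))).2 hsurj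
    have : P' ⟨fderiv ℝ h y (0, k), _, rfl⟩ = P' 0 := by
      rw [map_zero]
      exact DFunLike.congr_fun hfst (0, k)
    exact congrArg Subtype.val (hinj this)
  have hconst : ∀ y ∈ Metric.ball y₀ ε, h y = h (y.1, y₀.2) := by
    rintro ⟨y₁, y₂⟩ hy
    rw [hprod] at hy
    have hd : ∀ z ∈ Metric.ball y₀.2 ε, HasFDerivAt (fun z => h (y₁, z)) (0 : A.ker →L[ℝ] F) z := by
      intro z hz
      have hyz : (y₁, z) ∈ Metric.ball y₀ ε := by
        rw [hprod]; exact ⟨hy.1, hz⟩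
      have h1 : HasFDerivAt h (fderiv ℝ h (y₁, z)) (y₁, z) :=
        ((hhC _ hyz).differentiableAt (by simp)).hasFDerivAt
      have h2 := h1.comp z (hasFDerivAt_prodMk_right y₁ z)
      rwa [show (fderiv ℝ h (y₁, z)).comp (ContinuousLinearMap.inr ℝ A.range A.ker) = 0 from
        ContinuousLinearMap.ext (hzero _ hyz)] at h2
    exact Metric.isOpen_ball.is_const_of_fderiv_eq_zero (convex_ball _ _).isPreconnected
      (fun z hz => (hd z hz).differentiableAt.differentiableWithinAt)
      (fun z hz => (hd z hz).fderiv) hy.2 (Metric.mem_ball_self hε)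
  have himg : h '' Metric.ball y₀ ε ∈ 𝓝 (f x₀) := by
    apply ho
    have h1 : ∀ᶠ x in 𝓝 x₀, x ∈ e.source ∧ Φ x ∈ Metric.ball y₀ ε :=
      (show ∀ᶠ x in 𝓝 x₀, x ∈ e.source from e.open_source.mem_nhds hex).and
        (hΦ.continuousAt.eventually (Metric.isOpen_ball.mem_nhds (Metric.mem_ball_self hε)))
    rw [Filter.mem_map]
    filter_upwards [h1] with x hx
    exact ⟨Φ x, hx.2, congrArg f (e.left_inv hx.1)⟩
  have hsub : h '' Metric.ball y₀ ε ⊆ (fun z => h (z, y₀.2)) '' Metric.ball y₀.1 ε := by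
    rintro _ ⟨y, hy, rfl⟩
    refine ⟨y.1, ?_, (hconst y hy).symm⟩
    rw [hprod] at hy
    exact hy.1
  -- The image is already covered by a `C¹` map on a ball of `A.range`. Being a neighbourhood of `f
  -- x₀`, it has the full dimension of `F`, which forces `A` to be onto.
  have hle : dimH (h '' Metric.ball y₀ ε) ≤ Module.finrank ℝ A.range := by
    have hC : ContDiffOn ℝ 1 (fun z => h (z, y₀.2)) (Metric.ball y₀.1 ε) := by
      intro z hz
      have : (z, y₀.2) ∈ Metric.ball y₀ ε := by
        rw [hprod]; exact ⟨hz, Metric.mem_ball_self hε⟩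
      exact ((hhC _ this).comp z (contDiffAt_id.prodMk contDiffAt_const)).contDiffWithinAt
    calc dimH (h '' Metric.ball y₀ ε)
        ≤ dimH ((fun z => h (z, y₀.2)) '' Metric.ball y₀.1 ε) := dimH_mono hsub
      _ ≤ dimH (Metric.ball y₀.1 ε) := hC.dimH_image_le (convex_ball _ _) subset_rfl
      _ ≤ dimH (univ : Set A.range) := dimH_mono (subset_univ _)
      _ = _ := Real.dimH_univ_eq_finrank _
  rw [Real.dimH_of_mem_nhds himg, Nat.cast_le] at hle
  have htop : A.range = ⊤ :=
    Submodule.eq_top_of_finrank_eq (le_antisymm (Submodule.finrank_le _) hle)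
  exact LinearMap.range_eq_top.1 htop

/-- Infinitesimal form of the compatibility `Φ (μ (u, v), y) = Φ (u, Φ (v, y))` of a local action
`Φ` with a local multiplication `μ`: the generators of `Φ` form an antihomomorphism for the bracket
of the left invariant vector fields of `μ`. -/
theorem fderiv_generator_sub_eq_lieBracket {Φ : E × F → F} {μ : E × E → E} {c : E} {y₀ : F}
    (hΦ : ContDiffAt ℝ 2 Φ (c, y₀)) (hμ : ContDiffAt ℝ 2 μ (c, c))
    (hΦ1 : Φ (c, y₀) = y₀) (hμ1 : ∀ᶠ u in 𝓝 c, μ (u, c) = u) (hμ2 : ∀ᶠ v in 𝓝 c, μ (c, v) = v)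
    (hact : ∀ᶠ p : E × E in 𝓝 (c, c), Φ (μ p, y₀) = Φ (p.1, Φ (p.2, y₀)))
    {a : F → E →L[ℝ] F} (ha : ∀ᶠ y in 𝓝 y₀, a y = fderiv ℝ (fun u => Φ (u, y)) c)
    {X : E → E → E}
    (hX : ∀ ζ, ∀ᶠ u in 𝓝 c, X ζ u = fderiv ℝ (fun v => μ (u, v)) c ζ) (ξ η : E) :
    fderiv ℝ a y₀ (a y₀ η) ξ - fderiv ℝ a y₀ (a y₀ ξ) η
      = a y₀ (VectorField.lieBracket ℝ (X ξ) (X η) c) := by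
  have hΦd : ∀ᶠ p in 𝓝 (c, y₀), DifferentiableAt ℝ Φ p :=
    (hΦ.eventually (by simp)).mono fun p hp => hp.differentiableAt (by simp)
  have hμd : ∀ᶠ p in 𝓝 (c, c), DifferentiableAt ℝ μ p :=
    (hμ.eventually (by simp)).mono fun p hp => hp.differentiableAt (by simp)
  have hΦ2 : DifferentiableAt ℝ (fderiv ℝ Φ) (c, y₀) :=
    (hΦ.fderiv_right (m := 1) (by norm_num)).differentiableAt (by simp)
  have hμ2' : DifferentiableAt ℝ (fderiv ℝ μ) (c, c) :=
    (hμ.fderiv_right (m := 1) (by norm_num)).differentiableAt (by simp)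
  have hsym : ∀ p q, fderiv ℝ (fderiv ℝ Φ) (c, y₀) p q = fderiv ℝ (fderiv ℝ Φ) (c, y₀) q p :=
    fun p q => (hΦ.isSymmSndFDerivAt (by simp)).eq p q
  have hcy : Filter.Tendsto (fun y : F => (c, y)) (𝓝 y₀) (𝓝 (c, y₀)) :=
    (Continuous.prodMk_right c).tendsto _
  have huy : Filter.Tendsto (fun u : E => (u, y₀)) (𝓝 c) (𝓝 (c, y₀)) :=
    (Continuous.prodMk_left y₀).tendsto _
  have huc : Filter.Tendsto (fun u : E => (u, c)) (𝓝 c) (𝓝 (c, c)) :=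
    (Continuous.prodMk_left c).tendsto _
  have ha' : a =ᶠ[𝓝 y₀]
      fun y => (fderiv ℝ Φ (c, y)).comp (ContinuousLinearMap.inl ℝ E F) := by
    filter_upwards [ha, hcy.eventually hΦd] with y hy hd
    rw [hy]
    exact (hd.hasFDerivAt.comp c (hasFDerivAt_prodMk_left c y)).fderiv
  have hDa : ∀ w ζ, fderiv ℝ a y₀ w ζ = fderiv ℝ (fderiv ℝ Φ) (c, y₀) (0, w) (ζ, 0) := by
    intro w ζ
    have h1 : HasFDerivAt (fun y => fderiv ℝ Φ (c, y)) _ y₀ :=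
      hΦ2.hasFDerivAt.comp y₀ (hasFDerivAt_prodMk_right c y₀)
    rw [ha'.fderiv_eq,
      (h1.clm_comp (hasFDerivAt_const (ContinuousLinearMap.inl ℝ E F) y₀)).fderiv]
    simp
  have ha₀ : ∀ ζ, a y₀ ζ = fderiv ℝ Φ (c, y₀) (ζ, 0) := fun ζ => by
    rw [ha'.eq_of_nhds]; simp
  have hX' : ∀ ζ, X ζ =ᶠ[𝓝 c] fun u => fderiv ℝ μ (u, c) (0, ζ) := by
    intro ζ
    filter_upwards [hX ζ, huc.eventually hμd] with u hu hd
    rw [hu]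
    exact congrArg (fun T : E →L[ℝ] E => T ζ)
      (hd.hasFDerivAt.comp c (hasFDerivAt_prodMk_right u c)).fderiv
  have hXd : ∀ ζ, DifferentiableAt ℝ (X ζ) c := by
    intro ζ
    have h1 := HasFDerivAt.comp (f := fun u => (u, c)) c hμ2'.hasFDerivAt
      (hasFDerivAt_prodMk_left c c)
    have h2 := h1.clm_apply (hasFDerivAt_const ((0 : E), ζ) c)
    exact h2.differentiableAt.congr_of_eventuallyEq (hX' ζ)
  have hX₀ : ∀ ζ, X ζ c = ζ := by
    intro ζ
    rw [(hX ζ).self_of_nhds]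
    have : (fun v => μ (c, v)) =ᶠ[𝓝 c] id := hμ2
    rw [this.fderiv_eq, fderiv_id]
    rfl
  -- Differentiate `Φ (μ (u, v), y₀) = Φ (u, Φ (v, y₀))` in `v` at the unit `c`, for fixed `u`.
  have key : ∀ ζ, ∀ᶠ u in 𝓝 c,
      fderiv ℝ Φ (u, y₀) (X ζ u, 0) = fderiv ℝ Φ (u, y₀) (0, a y₀ ζ) := by
    intro ζ
    filter_upwards [hact.curry_nhds, hX' ζ, hμ1, huc.eventually hμd, huy.eventually hΦd]
      with u hu hXu hμu hdμ hdΦ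
    have h1 : HasFDerivAt (fun v => Φ (μ (u, v), y₀))
        ((fderiv ℝ Φ (u, y₀)).comp ((ContinuousLinearMap.inl ℝ E F).comp
          ((fderiv ℝ μ (u, c)).comp (ContinuousLinearMap.inr ℝ E E)))) c := by
      have hm := hdμ.hasFDerivAt.comp c (hasFDerivAt_prodMk_right u c)
      have hm' := (hasFDerivAt_prodMk_left (𝕜 := ℝ) (μ (u, c)) y₀).comp c hm
      refine HasFDerivAt.comp (g := Φ) c ?_ hm'
      change HasFDerivAt Φ _ (μ (u, c), y₀)
      rw [hμu]
      exact hdΦ.hasFDerivAt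
    have h2 : HasFDerivAt (fun v => Φ (u, Φ (v, y₀)))
        ((fderiv ℝ Φ (u, y₀)).comp ((ContinuousLinearMap.inr ℝ E F).comp
          ((fderiv ℝ Φ (c, y₀)).comp (ContinuousLinearMap.inl ℝ E F)))) c := by
      have hm := HasFDerivAt.comp (f := fun u => (u, y₀)) c hΦd.self_of_nhds.hasFDerivAt
        (hasFDerivAt_prodMk_left c y₀)
      have hm' := (hasFDerivAt_prodMk_right (𝕜 := ℝ) u (Φ (c, y₀))).comp c hm
      refine HasFDerivAt.comp (g := Φ) c ?_ hm'
      change HasFDerivAt Φ _ (u, Φ (c, y₀))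
      rw [hΦ1]
      exact hdΦ.hasFDerivAt
    have h3 := h1.unique (h2.congr_of_eventuallyEq hu)
    have h4 := DFunLike.congr_fun h3 ζ
    rw [hXu, ha₀]
    simpa using h4
  -- Differentiate `key` in `u` at `c`. Antisymmetrizing in `ζ, ζ'` cancels the pure second
  -- derivative by symmetry and leaves the bracket.
  have key' : ∀ ζ ζ', fderiv ℝ (fderiv ℝ Φ) (c, y₀) (ζ', 0) (ζ, 0)
      + a y₀ (fderiv ℝ (X ζ) c ζ')
      = fderiv ℝ (fderiv ℝ Φ) (c, y₀) (ζ', 0) (0, a y₀ ζ) := by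
    intro ζ ζ'
    have hD := HasFDerivAt.comp (f := fun u => (u, y₀)) c hΦ2.hasFDerivAt
      (hasFDerivAt_prodMk_left c y₀)
    have h1 := hD.clm_apply ((hasFDerivAt_prodMk_left (𝕜 := ℝ) (X ζ c) (0 : F)).comp c
      (hXd ζ).hasFDerivAt)
    have h2 := hD.clm_apply (hasFDerivAt_const ((0 : E), a y₀ ζ) c)
    have h3 := h1.unique (h2.congr_of_eventuallyEq (key ζ))
    have h4 := DFunLike.congr_fun h3 ζ'
    rw [ha₀ (fderiv ℝ (X ζ) c ζ')]
    simp [hX₀] at h4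
    rw [add_comm]
    simpa using h4
  have k1 := key' η ξ
  have k2 := key' ξ η
  rw [hsym (η, 0) (ξ, 0)] at k2
  rw [hDa, hDa, hsym (0, _), hsym (0, _), ← k1, ← k2, VectorField.lieBracket, hX₀, hX₀, map_sub]
  abel

section Variation

variable {S : Set ℝ} {t : ℝ} {y : ℝ → F} {Λ : F × F → ℝ} {a : F → E →L[ℝ] F}

/-- Partial derivatives of a reduced Lagrangian `(ζ, z) ↦ Λ (z, a z ζ)` in the second variable. -/
theorem fderiv_reduced_base {y₀ : F} {ξ : E}
    (hΛ : DifferentiableAt ℝ Λ (y₀, a y₀ ξ)) (ha : DifferentiableAt ℝ a y₀) (w : F) :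
    fderiv ℝ (fun z => Λ (z, a z ξ)) y₀ w
      = fderiv ℝ (fun z => Λ (z, a y₀ ξ)) y₀ w
        + fderiv ℝ (fun v => Λ (y₀, v)) (a y₀ ξ) (fderiv ℝ a y₀ w ξ) := by
  have h1 := (HasFDerivAt.comp (f := fun z => (z, a y₀ ξ)) y₀ hΛ.hasFDerivAt
    (hasFDerivAt_prodMk_left y₀ (a y₀ ξ))).fderiv
  have h2 := (hΛ.hasFDerivAt.comp (a y₀ ξ) (hasFDerivAt_prodMk_right y₀ (a y₀ ξ))).fderiv
  have h3 := (HasFDerivAt.comp (g := Λ) y₀ hΛ.hasFDerivAt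
    ((hasFDerivAt_id y₀).prodMk (ha.hasFDerivAt.clm_apply (hasFDerivAt_const ξ y₀)))).fderiv
  have h1' : fderiv ℝ (fun z => Λ (z, a y₀ ξ)) y₀ = _ := h1
  have h2' : fderiv ℝ (fun v => Λ (y₀, v)) (a y₀ ξ) = _ := h2
  have h3' : fderiv ℝ (fun z => Λ (z, a z ξ)) y₀ = _ := h3
  rw [h1', h2', h3']
  simp only [ContinuousLinearMap.comp_apply, ← map_add]
  congr 1
  simp

/-- Time derivative of the fibre derivative of a reduced Lagrangian along a curve. -/
theorem derivWithin_fderiv_reduced {ξ : ℝ → E} (hS : UniqueDiffOn ℝ S) (htS : t ∈ S)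
    (hy : ContDiffWithinAt ℝ ∞ y S t)
    (hΛ : ContDiffAt ℝ ∞ Λ (y t, derivWithin y S t)) (ha : ContDiffAt ℝ ∞ a (y t))
    (hξ : ∀ᶠ s in 𝓝[S] t, derivWithin y S s = a (y s) (ξ s)) (η : E) :
    derivWithin (fun s => fderiv ℝ (fun ζ => Λ (y s, a (y s) ζ)) (ξ s)) S t η
      = derivWithin (fun s => fderiv ℝ (fun v => Λ (y s, v)) (derivWithin y S s)) S t (a (y t) η)
        + fderiv ℝ (fun v => Λ (y t, v)) (derivWithin y S t)
            (fderiv ℝ a (y t) (derivWithin y S t) η) := by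
  have h2 : (1 : WithTop ℕ∞) + 1 ≤ ∞ := by
    rw [one_add_one_eq_two]
    exact WithTop.coe_le_coe.2 le_top
  have hy' : DifferentiableWithinAt ℝ (derivWithin y S) S t := by
    have h := (hy.fderivWithin_right hS h2 htS).differentiableWithinAt (by simp)
    exact h.clm_apply (differentiableWithinAt_const (1 : ℝ))
  have hyd : DifferentiableWithinAt ℝ y S t := hy.differentiableWithinAt (by simp)
  have hpair : ContinuousWithinAt (fun s => (y s, derivWithin y S s)) S t :=
    hyd.continuousWithinAt.prodMk hy'.continuousWithinAt
  have hΛd : ∀ᶠ s in 𝓝[S] t, DifferentiableAt ℝ Λ (y s, derivWithin y S s) :=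
    hpair.eventually ((hΛ.of_le (m := 1) (by simp)).eventually (by simp) |>.mono
      fun p hp => hp.differentiableAt (by simp))
  have hp : (fun s => fderiv ℝ (fun v => Λ (y s, v)) (derivWithin y S s)) =ᶠ[𝓝[S] t]
      fun s => (fderiv ℝ Λ (y s, derivWithin y S s)).comp (ContinuousLinearMap.inr ℝ F F) := by
    filter_upwards [hΛd] with s hs
    exact (hs.hasFDerivAt.comp (derivWithin y S s) (hasFDerivAt_prodMk_right (y s) _)).fderiv
  have hpd : DifferentiableWithinAt ℝ
      (fun s => fderiv ℝ (fun v => Λ (y s, v)) (derivWithin y S s)) S t := by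
    have h1 : DifferentiableAt ℝ (fderiv ℝ Λ) (y t, derivWithin y S t) :=
      (hΛ.fderiv_right h2).differentiableAt (by simp)
    have h2 : DifferentiableWithinAt ℝ (fun s => fderiv ℝ Λ (y s, derivWithin y S s)) S t :=
      h1.comp_differentiableWithinAt (f := fun s => (y s, derivWithin y S s)) t (hyd.prodMk hy')
    exact (h2.clm_comp (differentiableWithinAt_const _)).congr_of_eventuallyEq_of_mem hp htS
  -- The momentum in `𝔤*` is the fibre momentum composed with `a`, so the product rule gives the two
  -- terms.
  have hd : (fun s => fderiv ℝ (fun ζ => Λ (y s, a (y s) ζ)) (ξ s)) =ᶠ[𝓝[S] t]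
      fun s => (fderiv ℝ (fun v => Λ (y s, v)) (derivWithin y S s)).comp (a (y s)) := by
    filter_upwards [hΛd, hξ] with s hs hξs
    have h1 : DifferentiableAt ℝ (fun v => Λ (y s, v)) (derivWithin y S s) :=
      (hs.hasFDerivAt.comp (derivWithin y S s)
        (hasFDerivAt_prodMk_right (y s) _)).differentiableAt
    rw [hξs] at h1 ⊢
    exact (h1.hasFDerivAt.comp (ξ s) (a (y s)).hasFDerivAt).fderiv
  have had : HasDerivWithinAt (fun s => a (y s)) (fderiv ℝ a (y t) (derivWithin y S t)) S t :=
    (ha.differentiableAt (by simp)).hasFDerivAt.comp_hasDerivWithinAt t hyd.hasDerivWithinAt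
  have h := hpd.hasDerivWithinAt.clm_comp had
  rw [hd.derivWithin_eq_of_mem htS, h.derivWithin (hS t htS)]
  simp

end Variation

end Calculus

/-! ### Lagrangian, action and generators in charts -/

section Charts

variable {E : Type*} [NormedAddCommGroup E] [NormedSpace ℝ E]
  {F : Type*} [NormedAddCommGroup F] [NormedSpace ℝ F]
  {G : Type*} [TopologicalSpace G] [ChartedSpace E G] [Group G]
  {M : Type*} [TopologicalSpace M] [ChartedSpace F M]

/-- The tangent space at `x` is identified with `F` by the preferred chart at `x`, so no derivative
of a transition map appears. -/
theorem mfderiv_eq_fderiv_chart {f : M → E} {x : M}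
    (hf : MDifferentiableAt 𝓘(ℝ, F) 𝓘(ℝ, E) f x) :
    (mfderiv 𝓘(ℝ, F) 𝓘(ℝ, E) f x : F →L[ℝ] E)
      = fderiv ℝ (fun u => f ((chartAt F x).symm u)) (chartAt F x x) := by
  refine (if_pos hf).trans ?_
  change fderivWithin ℝ (fun u => f ((chartAt F x).symm u)) (range id) (chartAt F x x) = _
  rw [range_id, fderivWithin_univ]

section Atlas

variable {e : OpenPartialHomeomorph M F}

theorem mdifferentiable_of_mem_maximalAtlas (he : e ∈ IsManifold.maximalAtlas 𝓘(ℝ, F) ∞ M) :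
    e.MDifferentiable 𝓘(ℝ, F) 𝓘(ℝ, F) :=
  ⟨(contMDiffOn_of_mem_maximalAtlas he).mdifferentiableOn (by simp),
    (contMDiffOn_symm_of_mem_maximalAtlas he).mdifferentiableOn (by simp)⟩

theorem lagrangian_eq_chartLagrangian (L : TangentBundle 𝓘(ℝ, F) M → ℝ)
    (he : e ∈ IsManifold.maximalAtlas 𝓘(ℝ, F) ∞ M) {x : M} (hx : x ∈ e.source)
    (v : TangentSpace 𝓘(ℝ, F) x) :
    L ⟨x, v⟩ = chartLagrangian L e (e x) (mfderiv 𝓘(ℝ, F) 𝓘(ℝ, F) e x v) := by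
  have h := (mdifferentiable_of_mem_maximalAtlas he).symm_comp_deriv hx
  have h' : mfderiv 𝓘(ℝ, F) 𝓘(ℝ, F) e.symm (e x) (mfderiv 𝓘(ℝ, F) 𝓘(ℝ, F) e x v) = v :=
    DFunLike.congr_fun h v
  unfold chartLagrangian
  rw [h', e.left_inv hx]

/-- On the open set `e.target ×ˢ univ` this function is `L` composed with the tangent map of
`e.symm`, which is smooth. -/
theorem contDiffAt_chartLagrangian [IsManifold 𝓘(ℝ, F) ∞ M] {L : TangentBundle 𝓘(ℝ, F) M → ℝ}
    (hL : ContMDiff (𝓘(ℝ, F).tangent) 𝓘(ℝ, ℝ) ∞ L)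
    (he : e ∈ IsManifold.maximalAtlas 𝓘(ℝ, F) ∞ M) {y : F} (hy : y ∈ e.target) (v : F) :
    ContDiffAt ℝ ∞ (fun p : F × F => chartLagrangian L e p.1 p.2) (y, v) := by
  have h1 := (contMDiffOn_symm_of_mem_maximalAtlas he).contMDiffOn_tangentMapWithin (m := ∞)
    (by simp) e.open_target.uniqueMDiffOn
  have h2 : ContMDiff 𝓘(ℝ, F × F) 𝓘(ℝ, F).tangent ∞
      (fun p : F × F => (⟨p.1, p.2⟩ : TangentBundle 𝓘(ℝ, F) F)) := by
    rw [modelWithCornersSelf_prod]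
    exact contMDiff_tangentBundleModelSpaceHomeomorph_symm (I := 𝓘(ℝ, F)) (n := ∞)
  have h3 := hL.comp_contMDiffOn (h1.comp (s := e.target ×ˢ univ) h2.contMDiffOn
    (fun p hp => hp.1))
  have h4 : ContDiffOn ℝ ∞ (fun p : F × F => chartLagrangian L e p.1 p.2)
      (e.target ×ˢ univ) := by
    rw [← contMDiffOn_iff_contDiffOn]
    refine ContMDiffOn.congr h3 fun p hp => ?_
    simp only [Function.comp, tangentMapWithin, chartLagrangian]
    congr 2
    exact congrArg (fun T : F →L[ℝ] F => T p.2) (mfderivWithin_of_isOpen e.open_target hp.1).symm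
  exact h4.contDiffAt ((e.open_target.prod isOpen_univ).mem_nhds ⟨hy, mem_univ _⟩)

end Atlas

/-- The action of `G` in the chart of `G` at `1` and a chart `e` of `M`. -/
def localAction [SMul G M] (e : OpenPartialHomeomorph M F) (p : E × F) : F :=
  e ((chartAt E (1 : G)).symm p.1 • e.symm p.2)

variable (E G) in
/-- The map `𝔤 → F`, `ξ ↦ ξ_M`, in a chart `e` of `M`. -/
def chartGenerator [SMul G M] (e : OpenPartialHomeomorph M F) (y : F) : E →L[ℝ] F :=
  fderiv ℝ (fun u : E => localAction (G := G) e (u, y)) (chartAt E (1 : G) 1)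

section Action

variable [MulAction G M] [LieGroup 𝓘(ℝ, E) ∞ G] [ContMDiffSMul 𝓘(ℝ, E) 𝓘(ℝ, F) ∞ G M]
  {e : OpenPartialHomeomorph M F}

omit [LieGroup 𝓘(ℝ, E) ∞ G] in
theorem contMDiff_smul_const (x : M) :
    ContMDiff 𝓘(ℝ, E) 𝓘(ℝ, F) ∞ (fun g : G => g • x) :=
  contMDiff_id.smul contMDiff_const

theorem contDiffAt_localAction (he : e ∈ IsManifold.maximalAtlas 𝓘(ℝ, F) ∞ M) {u : E} {y : F}
    (hu : u ∈ (chartAt E (1 : G)).target) (hy : y ∈ e.target)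
    (huy : (chartAt E (1 : G)).symm u • e.symm y ∈ e.source) :
    ContDiffAt ℝ ∞ (localAction (G := G) e) (u, y) := by
  rw [← contMDiffAt_iff_contDiffAt]
  have h1 : ContMDiffAt 𝓘(ℝ, E × F) 𝓘(ℝ, E) ∞
      (fun p : E × F => (chartAt E (1 : G)).symm p.1) (u, y) := by
    have := (contMDiffOn_symm_of_mem_maximalAtlas (I := 𝓘(ℝ, E)) (n := ∞)
      (IsManifold.chart_mem_maximalAtlas (1 : G))).contMDiffAt
      ((chartAt E (1 : G)).open_target.mem_nhds hu)
    exact this.comp (u, y) contDiff_fst.contMDiff.contMDiffAt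
  have h2 : ContMDiffAt 𝓘(ℝ, E × F) 𝓘(ℝ, F) ∞ (fun p : E × F => e.symm p.2) (u, y) := by
    have := (contMDiffOn_symm_of_mem_maximalAtlas he).contMDiffAt (e.open_target.mem_nhds hy)
    exact this.comp (u, y) contDiff_snd.contMDiff.contMDiffAt
  have h3 := h1.smul (I := 𝓘(ℝ, E)) h2
  exact ((contMDiffOn_of_mem_maximalAtlas he).contMDiffAt (e.open_source.mem_nhds huy)).comp
    (u, y) h3

variable (G) in
theorem contDiffAt_localAction_one (he : e ∈ IsManifold.maximalAtlas 𝓘(ℝ, F) ∞ M) {y : F}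
    (hy : y ∈ e.target) :
    ContDiffAt ℝ ∞ (localAction (G := G) e) (chartAt E (1 : G) 1, y) := by
  refine contDiffAt_localAction he ((chartAt E (1 : G)).map_source (mem_chart_source E 1)) hy ?_
  rw [(chartAt E (1 : G)).left_inv (mem_chart_source E 1), one_smul]
  exact e.map_target hy

variable (G) in
theorem contDiffAt_chartGenerator (he : e ∈ IsManifold.maximalAtlas 𝓘(ℝ, F) ∞ M) {y : F}
    (hy : y ∈ e.target) : ContDiffAt ℝ ∞ (chartGenerator E G e) y := by
  have h := contDiffAt_localAction_one (E := E) G he hy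
  refine ContDiffAt.fderiv (n := ∞) (f := fun y u => localAction (G := G) e (u, y)) ?_
    contDiffAt_const (by simp)
  exact ContDiffAt.comp (g := localAction (G := G) e) (f := fun p : F × E => (p.2, p.1))
    (y, chartAt E (1 : G) 1) h (contDiff_snd.prodMk contDiff_fst).contDiffAt

omit [LieGroup 𝓘(ℝ, E) ∞ G] in
variable (G) in
theorem mfderiv_generatorMap (he : e ∈ IsManifold.maximalAtlas 𝓘(ℝ, F) ∞ M) {x : M}
    (hx : x ∈ e.source) (ξ : GroupLieAlgebra 𝓘(ℝ, E) G) :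
    (mfderiv 𝓘(ℝ, F) 𝓘(ℝ, F) e x (generator ξ x) : F) = chartGenerator E G e (e x) ξ := by
  have hs : MDifferentiableAt 𝓘(ℝ, E) 𝓘(ℝ, F) (fun g : G => g • x) 1 :=
    (contMDiff_smul_const x).mdifferentiable (by simp) 1
  have hd := (mdifferentiable_of_mem_maximalAtlas he).mdifferentiableAt hx
  have hd1 : MDifferentiableAt 𝓘(ℝ, F) 𝓘(ℝ, F) e ((1 : G) • x) := by rwa [one_smul]
  have h1 : mfderiv 𝓘(ℝ, E) 𝓘(ℝ, F) (fun g : G => e (g • x)) 1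
    = (mfderiv 𝓘(ℝ, F) 𝓘(ℝ, F) e ((1 : G) • x)).comp
      (mfderiv 𝓘(ℝ, E) 𝓘(ℝ, F) (fun g : G => g • x) 1) := mfderiv_comp (1 : G) hd1 hs
  have h2 := mfderiv_eq_fderiv_chart (f := fun g : G => e (g • x)) (x := 1) (hd1.comp (1 : G) hs)
  rw [h1] at h2
  have h3 : chartGenerator E G e (e x)
      = fderiv ℝ (fun u => e ((chartAt E (1 : G)).symm u • x)) (chartAt E (1 : G) 1) := by
    unfold chartGenerator localAction
    simp only [e.left_inv hx]
  rw [h3, ← h2]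
  -- `1 • x` and `x` are only propositionally equal, so their tangent spaces are compared by
  -- substitution over a free point.
  have h4 : ∀ x' : M, x' = x → ∀ w : F, (mfderiv 𝓘(ℝ, F) 𝓘(ℝ, F) e x w : F)
      = mfderiv 𝓘(ℝ, F) 𝓘(ℝ, F) e x' w := by
    rintro _ rfl w
    rfl
  exact h4 _ (one_smul G x) _

end Action

end Charts

/-! ### The left invariant bracket and transitivity in charts -/

section Charts

variable {E : Type*} [NormedAddCommGroup E] [NormedSpace ℝ E]
  {F : Type*} [NormedAddCommGroup F] [NormedSpace ℝ F]
  {G : Type*} [TopologicalSpace G] [ChartedSpace E G] [Group G]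
  {M : Type*} [TopologicalSpace M] [ChartedSpace F M]
  {e : OpenPartialHomeomorph M F}

theorem mfderiv_mfderivWithin_eq_derivWithin {S : Set ℝ} {t : ℝ} {m : ℝ → M}
    (he : e ∈ IsManifold.maximalAtlas 𝓘(ℝ, F) ∞ M) (hS : UniqueDiffOn ℝ S) (htS : t ∈ S)
    (hm : MDifferentiableWithinAt 𝓘(ℝ, ℝ) 𝓘(ℝ, F) m S t) (ht : m t ∈ e.source) :
    (mfderiv 𝓘(ℝ, F) 𝓘(ℝ, F) e (m t) (mfderivWithin 𝓘(ℝ, ℝ) 𝓘(ℝ, F) m S t (1 : ℝ)) : F)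
      = derivWithin (e ∘ m) S t := by
  have hd := (mdifferentiable_of_mem_maximalAtlas he).mdifferentiableAt ht
  have h1 := mfderiv_comp_mfderivWithin t hd hm (hS t htS).uniqueMDiffWithinAt
  have h2 : (mfderivWithin 𝓘(ℝ, ℝ) 𝓘(ℝ, F) (e ∘ m) S t : ℝ →L[ℝ] F)
      = fderivWithin ℝ (e ∘ m) S t := mfderivWithin_eq_fderivWithin
  have h3 := h2.symm.trans h1
  exact (DFunLike.congr_fun h3 (1 : ℝ)).symm

theorem contDiffAt_chart_map {φ : M → M} (hφ : ContMDiff 𝓘(ℝ, F) 𝓘(ℝ, F) ∞ φ)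
    (he : e ∈ IsManifold.maximalAtlas 𝓘(ℝ, F) ∞ M) {y : F} (hy : y ∈ e.target)
    (hφy : φ (e.symm y) ∈ e.source) : ContDiffAt ℝ ∞ (fun z => e (φ (e.symm z))) y := by
  rw [← contMDiffAt_iff_contDiffAt]
  have h2 := (contMDiffOn_symm_of_mem_maximalAtlas he).contMDiffAt (e.open_target.mem_nhds hy)
  exact ((contMDiffOn_of_mem_maximalAtlas he).contMDiffAt (e.open_source.mem_nhds hφy)).comp y
    (hφ.contMDiffAt.comp y h2)

variable [LieGroup 𝓘(ℝ, E) ∞ G]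

/-- The manifold bracket is the vector space bracket in the chart at `1`, transported back by the
derivative of that chart, which is the identity at `1`. -/
theorem bracket_eq_lieBracket (ξ η : GroupLieAlgebra 𝓘(ℝ, E) G) :
    (⁅ξ, η⁆ : GroupLieAlgebra 𝓘(ℝ, E) G) = VectorField.lieBracket ℝ
      (VectorField.mpullbackWithin 𝓘(ℝ, E) 𝓘(ℝ, E) (chartAt E (1 : G)).symm
        (mulInvariantVectorField ξ) univ)
      (VectorField.mpullbackWithin 𝓘(ℝ, E) 𝓘(ℝ, E) (chartAt E (1 : G)).symm
        (mulInvariantVectorField η) univ) (chartAt E (1 : G) 1) := by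
  have : IsManifold 𝓘(ℝ, E) 1 G := IsManifold.of_le (n := ∞) (by simp)
  refine (VectorField.mlieBracketWithin_apply (I := 𝓘(ℝ, E)) (s := univ) (x₀ := (1 : G))).trans ?_
  have hid : (mfderiv 𝓘(ℝ, E) 𝓘(ℝ, E) (extChartAt 𝓘(ℝ, E) (1 : G)) 1 : E →L[ℝ] E)
      = ContinuousLinearMap.id ℝ E := mfderiv_extChartAt_self
  refine (congrArg (fun T : E →L[ℝ] E => T.inverse _) hid).trans ?_
  rw [ContinuousLinearMap.inverse_id]
  change VectorField.lieBracketWithin ℝ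
    (VectorField.mpullbackWithin 𝓘(ℝ, E) 𝓘(ℝ, E) (chartAt E (1 : G)).symm
        (mulInvariantVectorField ξ) (range id))
      (VectorField.mpullbackWithin 𝓘(ℝ, E) 𝓘(ℝ, E) (chartAt E (1 : G)).symm
        (mulInvariantVectorField η) (range id)) (univ ∩ range id) (chartAt E (1 : G) 1) = _
  rw [range_id, univ_inter]
  exact congrFun VectorField.lieBracketWithin_univ _

/-- For `G` acting on itself, `localAction` is the local multiplication. The chain rule for `h ↦ c
(g * h)` at `1` puts left invariant fields in the form needed by
`fderiv_generator_sub_eq_lieBracket`. -/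
theorem mpullbackWithin_mulInvariantVectorField (ζ : GroupLieAlgebra 𝓘(ℝ, E) G) {u : E}
    (hu : u ∈ (chartAt E (1 : G)).target) :
    (VectorField.mpullbackWithin 𝓘(ℝ, E) 𝓘(ℝ, E) (chartAt E (1 : G)).symm
        (mulInvariantVectorField ζ) univ u : E)
      = fderiv ℝ (fun v => localAction (G := G) (chartAt E (1 : G)) (u, v))
          (chartAt E (1 : G) 1) ζ := by
  have hc := mdifferentiable_of_mem_maximalAtlas (F := E)
    (IsManifold.chart_mem_maximalAtlas (I := 𝓘(ℝ, E)) (n := ∞) (1 : G))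
  set c := chartAt E (1 : G) with hcdef
  have hg : c.symm u ∈ c.source := c.map_target hu
  have hinv : ContinuousLinearMap.inverse (mfderiv 𝓘(ℝ, E) 𝓘(ℝ, E) c.symm u : E →L[ℝ] E)
      = mfderiv 𝓘(ℝ, E) 𝓘(ℝ, E) c (c.symm u) := by
    have h1 : ∀ u', u' = u →
        (mfderiv 𝓘(ℝ, E) 𝓘(ℝ, E) c.symm u' : E →L[ℝ] E) = mfderiv 𝓘(ℝ, E) 𝓘(ℝ, E) c.symm u := by
      rintro _ rfl
      rfl
    have h2 := hc.symm_comp_deriv hg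
    refine ContinuousLinearMap.inverse_eq ?_ ?_
    · rw [← h1 _ (c.right_inv hu)]
      exact h2
    · exact hc.comp_symm_deriv hu
  set g := c.symm u with hgdef
  have hs : MDifferentiableAt 𝓘(ℝ, E) 𝓘(ℝ, E) (fun h : G => g * h) 1 :=
    (contMDiff_mul_left (I := 𝓘(ℝ, E)) (n := ∞)).mdifferentiable (by simp) 1
  have hd1 : MDifferentiableAt 𝓘(ℝ, E) 𝓘(ℝ, E) c (g * 1) := by
    rw [mul_one]
    exact hc.mdifferentiableAt hg
  have h1 : mfderiv 𝓘(ℝ, E) 𝓘(ℝ, E) (fun h : G => c (g * h)) 1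
    = (mfderiv 𝓘(ℝ, E) 𝓘(ℝ, E) c (g * 1)).comp
      (mfderiv 𝓘(ℝ, E) 𝓘(ℝ, E) (fun h : G => g * h) 1) := mfderiv_comp (1 : G) hd1 hs
  have h2 := mfderiv_eq_fderiv_chart (f := fun h : G => c (g * h)) (x := 1) (hd1.comp (1 : G) hs)
  rw [h1] at h2
  have h4 : ∀ g' : G, g' = g → ∀ w : E, (mfderiv 𝓘(ℝ, E) 𝓘(ℝ, E) c g w : E)
      = mfderiv 𝓘(ℝ, E) 𝓘(ℝ, E) c g' w := by
    rintro _ rfl w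
    rfl
  have h5 : (VectorField.mpullbackWithin 𝓘(ℝ, E) 𝓘(ℝ, E) c.symm
      (mulInvariantVectorField ζ) univ u : E)
      = ContinuousLinearMap.inverse (mfderiv 𝓘(ℝ, E) 𝓘(ℝ, E) c.symm u : E →L[ℝ] E)
        (mfderiv 𝓘(ℝ, E) 𝓘(ℝ, E) (fun h : G => g * h) 1 ζ) := by
    rw [← mfderivWithin_univ]
    rfl
  rw [h5, hinv]
  refine (h4 _ (mul_one g) _).trans ?_
  exact DFunLike.congr_fun h2 ζ

variable [MulAction G M] [ContMDiffSMul 𝓘(ℝ, E) 𝓘(ℝ, F) ∞ G M]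

/-- The generators of a left action form an antihomomorphism, in a chart. -/
theorem fderiv_chartGenerator_sub (he : e ∈ IsManifold.maximalAtlas 𝓘(ℝ, F) ∞ M) {y : F}
    (hy : y ∈ e.target) (ξ η : GroupLieAlgebra 𝓘(ℝ, E) G) :
    fderiv ℝ (chartGenerator E G e) y (chartGenerator E G e y η) ξ
      - fderiv ℝ (chartGenerator E G e) y (chartGenerator E G e y ξ) η
      = chartGenerator E G e y (⁅ξ, η⁆ : GroupLieAlgebra 𝓘(ℝ, E) G) := by
  have hc := IsManifold.chart_mem_maximalAtlas (I := 𝓘(ℝ, E)) (n := ∞) (1 : G)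
  have hcont : ContinuousSMul G M := ContMDiffSMul.continuousSMul (I := 𝓘(ℝ, E)) (I' := 𝓘(ℝ, F)) ∞
  have htop : IsTopologicalGroup G := topologicalGroup_of_lieGroup 𝓘(ℝ, E) ∞
  have h2 : (2 : WithTop ℕ∞) ≤ ∞ := WithTop.coe_le_coe.2 le_top
  set c := chartAt E (1 : G) with hcdef
  have h1s : (1 : G) ∈ c.source := mem_chart_source E 1
  have hct : c 1 ∈ c.target := c.map_source h1s
  have hc1 : c.symm (c 1) = 1 := c.left_inv h1s
  rw [bracket_eq_lieBracket]
  have hsymm : Filter.Tendsto c.symm (𝓝 (c 1)) (𝓝 1) := by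
    have := (c.continuousAt_symm hct).tendsto
    rwa [hc1] at this
  refine fderiv_generator_sub_eq_lieBracket (c := c 1) (Φ := localAction (G := G) e)
    (μ := localAction (G := G) c) ((contDiffAt_localAction_one G he hy).of_le h2)
    ((contDiffAt_localAction_one G hc hct).of_le h2) ?_ ?_ ?_ ?_
    (a := chartGenerator E G e) (Filter.Eventually.of_forall fun _ => rfl)
    (X := fun ζ u => VectorField.mpullbackWithin 𝓘(ℝ, E) 𝓘(ℝ, E) c.symm
      (mulInvariantVectorField (G := G) (I := 𝓘(ℝ, E)) ζ) univ u) ?_ ξ η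
  · simp only [localAction, ← hcdef]
    rw [hc1, one_smul, e.right_inv hy]
  · filter_upwards [c.open_target.mem_nhds hct] with u hu
    simp only [localAction, ← hcdef]
    rw [hc1, smul_eq_mul, mul_one, c.right_inv hu]
  · filter_upwards [c.open_target.mem_nhds hct] with u hu
    simp only [localAction, ← hcdef]
    rw [hc1, one_smul, c.right_inv hu]
  · have hf : Filter.Tendsto (fun p : E × E => c.symm p.1) (𝓝 (c 1, c 1)) (𝓝 1) :=
      hsymm.comp continuousAt_fst.tendsto
    have hs : Filter.Tendsto (fun p : E × E => c.symm p.2) (𝓝 (c 1, c 1)) (𝓝 1) :=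
      hsymm.comp continuousAt_snd.tendsto
    have hm : Filter.Tendsto (fun p : E × E => c.symm p.1 * c.symm p.2) (𝓝 (c 1, c 1))
        (𝓝 1) := by simpa using hf.mul hs
    have hx : Filter.Tendsto (fun p : E × E => c.symm p.2 • e.symm y) (𝓝 (c 1, c 1))
        (𝓝 (e.symm y)) := by simpa using hs.smul_const (e.symm y)
    filter_upwards [hm.eventually (c.open_source.mem_nhds h1s),
      hx.eventually (e.open_source.mem_nhds (e.map_target hy))] with p hp hp'
    simp only [localAction, ← hcdef]
    rw [smul_eq_mul, c.left_inv hp, e.left_inv hp', mul_smul]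
  · intro ζ
    filter_upwards [c.open_target.mem_nhds hct] with u hu
    exact mpullbackWithin_mulInvariantVectorField ζ hu

/-- The infinitesimal generators of a transitive action span the tangent spaces. -/
theorem surjective_chartGenerator [FiniteDimensional ℝ E] [FiniteDimensional ℝ F]
    [SecondCountableTopology G] [T2Space M] [MulAction.IsPretransitive G M]
    (he : e ∈ IsManifold.maximalAtlas 𝓘(ℝ, F) ∞ M) {y : F} (hy : y ∈ e.target) :
    Function.Surjective (chartGenerator E G e y) := by
  have hc := IsManifold.chart_mem_maximalAtlas (I := 𝓘(ℝ, E)) (n := ∞) (1 : G)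
  have hcont : ContinuousSMul G M := ContMDiffSMul.continuousSMul (I := 𝓘(ℝ, E)) (I' := 𝓘(ℝ, F)) ∞
  have htop : IsTopologicalGroup G := topologicalGroup_of_lieGroup 𝓘(ℝ, E) ∞
  have hG : LocallyCompactSpace G := Manifold.locallyCompact_of_finiteDimensional 𝓘(ℝ, E)
  have hM : LocallyCompactSpace M := Manifold.locallyCompact_of_finiteDimensional 𝓘(ℝ, F)
  set c := chartAt E (1 : G) with hcdef
  have h1s : (1 : G) ∈ c.source := mem_chart_source E 1
  have hct : c 1 ∈ c.target := c.map_source h1s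
  have hc1 : c.symm (c 1) = 1 := c.left_inv h1s
  set x := e.symm y with hx
  have hxs : x ∈ e.source := e.map_target hy
  have hcont' : Continuous (fun g : G => g • x) := continuous_id.smul continuous_const
  let f : E → F := fun u => e (c.symm u • x)
  have hf : ∀ u ∈ c.target, c.symm u • x ∈ e.source → ContDiffAt ℝ ∞ f u := fun u hu hux =>
    ContDiffAt.comp (g := localAction (G := G) e) (f := fun u => (u, y)) u
      (contDiffAt_localAction he hu hy hux) (contDiffAt_id.prodMk contDiffAt_const)
  have hcx : c.symm (c 1) • x ∈ e.source := by rwa [hc1, one_smul]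
  refine surjective_fderiv_of_nhds_le_map (f := f) (x₀ := c 1) ((hf _ hct hcx).of_le (by simp))
    ?_ ?_
  -- Equivariance: with `g = c.symm u`, translating by `g⁻¹` in `G` and by `g` in `M` factors
  -- `Df(u)` through `Df(c 1)`, so the rank at `u` is at most the rank at `c 1`.
  · have hev : ∀ᶠ u in 𝓝 (c 1), c.symm u • x ∈ e.source :=
      (hcont'.continuousAt.comp (c.continuousAt_symm hct)).eventually
        (e.open_source.mem_nhds hcx)
    filter_upwards [c.open_target.mem_nhds hct, hev] with u hu hux
    set g := c.symm u with hg
    let ℓ : E → E := fun v => c (g⁻¹ • c.symm v)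
    let k : F → F := fun z => e (g • e.symm z)
    have hℓu : ℓ u = c 1 := by simp [ℓ, ← hg]
    have hfy : f (c 1) = y := by
      change e (c.symm (c 1) • x) = y
      rw [hc1, one_smul, hx, e.right_inv hy]
    have hℓ : DifferentiableAt ℝ ℓ u := by
      refine (contDiffAt_chart_map (ContMDiffSMul.contMDiff_const_smul (I := 𝓘(ℝ, E)) g⁻¹)
        hc hu ?_).differentiableAt (by simp)
      rw [← hg, smul_eq_mul, inv_mul_cancel]
      exact h1s
    have hk : DifferentiableAt ℝ k y :=
      (contDiffAt_chart_map (ContMDiffSMul.contMDiff_const_smul (I := 𝓘(ℝ, E)) g)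
        he hy hux).differentiableAt (by simp)
    have hfd : DifferentiableAt ℝ f (c 1) := (hf _ hct hcx).differentiableAt (by simp)
    have hT : Filter.Tendsto (fun v => g⁻¹ * c.symm v) (𝓝 u) (𝓝 1) := by
      have := (c.continuousAt_symm hu).tendsto.const_mul g⁻¹
      rwa [← hg, inv_mul_cancel] at this
    have hT' : Filter.Tendsto (fun v => (g⁻¹ * c.symm v) • x) (𝓝 u) (𝓝 x) := by
      simpa using hT.smul_const x
    have heq : f =ᶠ[𝓝 u] fun v => k (f (ℓ v)) := by
      filter_upwards [hT.eventually (c.open_source.mem_nhds h1s),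
        hT'.eventually (e.open_source.mem_nhds hxs)] with v hv hv'
      simp only [f, k, ℓ]
      rw [smul_eq_mul, c.left_inv hv, e.left_inv hv', smul_smul, mul_inv_cancel_left]
    have hder : fderiv ℝ f u
        = (fderiv ℝ k y).comp ((fderiv ℝ f (c 1)).comp (fderiv ℝ ℓ u)) := by
      rw [heq.fderiv_eq]
      have hk' : HasFDerivAt k (fderiv ℝ k y) (f (ℓ u)) := by
        rw [hℓu, hfy]
        exact hk.hasFDerivAt
      have hf' : HasFDerivAt f (fderiv ℝ f (c 1)) (ℓ u) := by
        rw [hℓu]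
        exact hfd.hasFDerivAt
      exact (hk'.comp u (hf'.comp u hℓ.hasFDerivAt)).fderiv
    have hle : (fderiv ℝ f u).range
        ≤ ((fderiv ℝ f (c 1)).range).map (fderiv ℝ k y : F →ₗ[ℝ] F) := by
      rw [hder]
      rintro _ ⟨w, rfl⟩
      exact ⟨_, ⟨_, rfl⟩, rfl⟩
    exact (Submodule.finrank_mono hle).trans (Submodule.finrank_map_le _ _)
  · have h1 : Filter.map c.symm (𝓝 (c 1)) = 𝓝 1 := by
      have := c.symm.map_nhds_eq (x := c 1) hct
      rwa [hc1] at this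
    -- Open mapping theorem for group actions: `G` is σ-compact and `M` is a Baire space, both
    -- through local compactness.
    have h2 : 𝓝 x ≤ Filter.map (fun g : G => g • x) (𝓝 1) := by
      have := (isOpenMap_smul_of_sigmaCompact (G := G) x).nhds_le 1
      rwa [one_smul] at this
    have h3 : Filter.map f (𝓝 (c 1)) = Filter.map e (Filter.map (fun g : G => g • x)
        (Filter.map c.symm (𝓝 (c 1)))) := by
      rw [Filter.map_map, Filter.map_map]
      rfl
    have h4 : f (c 1) = e x := by
      change e (c.symm (c 1) • x) = e x
      rw [hc1, one_smul]
    rw [h3, h1, h4, ← e.map_nhds_eq hxs]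
    exact Filter.map_mono h2

end Charts

/-! ### Smooth solutions of linear equations along a curve -/

section Gluing

variable {E : Type*} [NormedAddCommGroup E] [NormedSpace ℝ E]
  {F : Type*} [NormedAddCommGroup F] [NormedSpace ℝ F]

/-- Smooth local selections of a family of convex sets glue to a global one. -/
theorem exists_contDiffOn_forall_mem_convex_of_local {S : Set ℝ} (hS : IsClosed S)
    {P : ℝ → Set E} (hP : ∀ s ∈ S, Convex ℝ (P s))
    (h : ∀ t ∈ S, ∃ U : Set ℝ, IsOpen U ∧ t ∈ U ∧ ∃ ξ : ℝ → E,
      ContDiffOn ℝ ∞ ξ (S ∩ U) ∧ ∀ s ∈ S ∩ U, ξ s ∈ P s) :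
    ∃ ξ : ℝ → E, ContDiffOn ℝ ∞ ξ S ∧ ∀ s ∈ S, ξ s ∈ P s := by
  choose! U hU htU ξ hξ hξP using h
  obtain ⟨ρ, hρ⟩ := SmoothPartitionOfUnity.exists_isSubordinate 𝓘(ℝ, ℝ) hS
    (fun t : S => U t) (fun t => hU t t.2)
    (fun t ht => mem_iUnion.2 ⟨⟨t, ht⟩, htU t ht⟩)
  refine ⟨fun s => ∑ᶠ i : S, ρ i s • ξ i s, ?_, fun s hs => ?_⟩
  · intro s₀ hs₀
    have heq : (fun s => ∑ᶠ i : S, ρ i s • ξ i s) =ᶠ[𝓝 s₀]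
        fun s => ∑ i ∈ ρ.fintsupport s₀, ρ i s • ξ i s := by
      filter_upwards [ρ.eventually_finsupport_subset s₀] with s hs
      rw [← ρ.sum_finsupport_smul_eq_finsum s fun i s => ξ i s]
      refine Finset.sum_subset hs fun i _ hi => ?_
      have : ρ i s = 0 := by
        by_contra hne
        exact hi ((ρ.mem_finsupport s).2 hne)
      rw [this, zero_smul]
    refine ContDiffWithinAt.congr_of_eventuallyEq ?_ (heq.filter_mono nhdsWithin_le_nhds)
      heq.self_of_nhds
    refine ContDiffWithinAt.sum fun i hi => ?_
    have hsU : s₀ ∈ U i := hρ i ((ρ.mem_fintsupport_iff s₀ i).1 hi)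
    refine (ρ i).contMDiff.contDiff.contDiffAt.contDiffWithinAt.smul ?_
    exact (contDiffWithinAt_inter ((hU i i.2).mem_nhds hsU)).1 (hξ i i.2 s₀ ⟨hs₀, hsU⟩)
  · refine ρ.finsum_smul_mem_convex hs (fun i hi => ?_) (hP s hs)
    exact hξP i i.2 s ⟨hs, hρ i (subset_tsupport _ hi)⟩

/-- A smooth family of surjective linear equations can be solved smoothly, locally. -/
theorem exists_local_contDiffOn_solution [FiniteDimensional ℝ F]
    {S : Set ℝ} {A : ℝ → E →L[ℝ] F} {w : ℝ → F} (hA : ContDiffOn ℝ ∞ A S)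
    (hw : ContDiffOn ℝ ∞ w S) {t : ℝ} (ht : t ∈ S) (hsurj : Function.Surjective (A t)) :
    ∃ U : Set ℝ, IsOpen U ∧ t ∈ U ∧ ∃ ξ : ℝ → E,
      ContDiffOn ℝ ∞ ξ (S ∩ U) ∧ ∀ s ∈ S ∩ U, A s (ξ s) = w s := by
  obtain ⟨R₀, hR₀⟩ := (A t : E →ₗ[ℝ] F).exists_rightInverse_of_surjective
    (LinearMap.range_eq_top.2 hsurj)
  let R : F →L[ℝ] E := LinearMap.toContinuousLinearMap R₀
  -- `B t` is the identity and invertibility is an open condition, so `R (B s)⁻¹ (w s)` solves the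
  -- equation for `s` in `S` near `t`.
  let B : ℝ → F →L[ℝ] F := fun s => (A s).comp R
  have hB : ContDiffOn ℝ ∞ B S := hA.clm_comp contDiffOn_const
  have hBt : B t = (ContinuousLinearEquiv.refl ℝ F : F →L[ℝ] F) :=
    ContinuousLinearMap.ext fun v => DFunLike.congr_fun hR₀ v
  obtain ⟨U, hU, hUS⟩ := continuousOn_iff'.1 hB.continuousOn
    (range ((↑) : (F ≃L[ℝ] F) → F →L[ℝ] F)) (ContinuousLinearEquiv.isOpen (E := F) (F := F))
  have hinv : ∀ s ∈ S ∩ U, ∃ T : F ≃L[ℝ] F, (T : F →L[ℝ] F) = B s := fun s hs =>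
    (hUS.symm.subset ⟨hs.2, hs.1⟩).1
  refine ⟨U, hU, (hUS.subset ⟨⟨ContinuousLinearEquiv.refl ℝ F, hBt.symm⟩, ht⟩).1,
    fun s => R ((B s).inverse (w s)), ?_, ?_⟩
  · intro s hs
    obtain ⟨T, hT⟩ := hinv s hs
    have h1 : ContDiffAt ℝ ∞ ContinuousLinearMap.inverse (B s) := by
      rw [← hT]
      exact contDiffAt_map_inverse T
    have h2 : ContDiffWithinAt ℝ ∞ (fun s => (B s).inverse) (S ∩ U) s :=
      h1.comp_contDiffWithinAt s ((hB s hs.1).mono inter_subset_left)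
    exact R.contDiff.contDiffAt.comp_contDiffWithinAt s
      (h2.clm_apply ((hw s hs.1).mono inter_subset_left))
  · intro s hs
    obtain ⟨T, hT⟩ := hinv s hs
    change B s ((B s).inverse (w s)) = w s
    rw [← hT, ContinuousLinearMap.inverse_equiv]
    exact T.apply_symm_apply _

theorem fderiv_comp_clm_apply {A : E →L[ℝ] F} {φ : F → ℝ} {ζ : E}
    (hφ : DifferentiableAt ℝ φ (A ζ)) (κ : E) :
    fderiv ℝ (fun ζ => φ (A ζ)) ζ κ = fderiv ℝ φ (A ζ) (A κ) :=
  congrArg (fun T : E →L[ℝ] ℝ => T κ) (hφ.hasFDerivAt.comp ζ A.hasFDerivAt).fderiv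

end Gluing

/-! ### Reconstruction and equivalence of the two systems -/

section Main

variable {E : Type*} [NormedAddCommGroup E] [NormedSpace ℝ E]
  {F : Type*} [NormedAddCommGroup F] [NormedSpace ℝ F]
  {G : Type*} [TopologicalSpace G] [ChartedSpace E G] [Group G]
  {M : Type*} [TopologicalSpace M] [ChartedSpace F M]
  {e : OpenPartialHomeomorph M F} {S : Set ℝ} {m : ℝ → M}

theorem contDiffWithinAt_chart_curve (hm : ContMDiffOn 𝓘(ℝ, ℝ) 𝓘(ℝ, F) ∞ m S)
    (he : e ∈ IsManifold.maximalAtlas 𝓘(ℝ, F) ∞ M) {t : ℝ} (ht : t ∈ S)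
    (hmt : m t ∈ e.source) : ContDiffWithinAt ℝ ∞ (e ∘ m) S t := by
  rw [← contMDiffWithinAt_iff_contDiffWithinAt]
  exact ((contMDiffOn_of_mem_maximalAtlas he).contMDiffAt
    (e.open_source.mem_nhds hmt)).comp_contMDiffWithinAt t (hm t ht)

variable [MulAction G M] [LieGroup 𝓘(ℝ, E) ∞ G] [ContMDiffSMul 𝓘(ℝ, E) 𝓘(ℝ, F) ∞ G M]

omit [LieGroup 𝓘(ℝ, E) ∞ G] in
-- The derivative of a chart is injective, so reconstruction becomes a linear equation for `ζ` in
-- any chart.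
theorem mfderivWithin_eq_generator_iff (hm : ContMDiffOn 𝓘(ℝ, ℝ) 𝓘(ℝ, F) ∞ m S)
    (hS : UniqueDiffOn ℝ S) (he : e ∈ IsManifold.maximalAtlas 𝓘(ℝ, F) ∞ M) {t : ℝ} (ht : t ∈ S)
    (hmt : m t ∈ e.source) (ζ : GroupLieAlgebra 𝓘(ℝ, E) G) :
    mfderivWithin 𝓘(ℝ, ℝ) 𝓘(ℝ, F) m S t (1 : ℝ) = generator ζ (m t)
      ↔ derivWithin (e ∘ m) S t = chartGenerator E G e (e (m t)) ζ := by
  rw [← mfderiv_mfderivWithin_eq_derivWithin he hS ht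
    ((hm t ht).mdifferentiableWithinAt (by simp)) hmt, ← mfderiv_generatorMap G he hmt]
  exact ((mdifferentiable_of_mem_maximalAtlas he).mfderiv_injective hmt).eq_iff.symm

/-- Every smooth curve in a homogeneous space is generated by a smooth curve in the Lie algebra. -/
theorem exists_isReconstruction [FiniteDimensional ℝ E] [FiniteDimensional ℝ F]
    [SecondCountableTopology G] [IsManifold 𝓘(ℝ, F) ∞ M] [T2Space M]
    [MulAction.IsPretransitive G M] {t₀ t₁ : ℝ} (ht : t₀ < t₁)
    (hm : ContMDiffOn 𝓘(ℝ, ℝ) 𝓘(ℝ, F) ∞ m (Icc t₀ t₁)) :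
    ∃ ξ : ℝ → GroupLieAlgebra 𝓘(ℝ, E) G,
      IsSmoothLieAlgebraCurve t₀ t₁ ξ ∧ IsReconstruction (F := F) t₀ t₁ ξ m := by
  have hS := uniqueDiffOn_Icc ht
  refine exists_contDiffOn_forall_mem_convex_of_local (E := E) isClosed_Icc
    (P := fun s => {ζ : E | mfderivWithin 𝓘(ℝ, ℝ) 𝓘(ℝ, F) m (Icc t₀ t₁) s (1 : ℝ)
      = generator (G := G) (E := E) ζ (m s)}) ?_ ?_
  -- The admissible `ζ` at time `s` form the preimage of a point under a linear map, hence a convex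
  -- set.
  · intro s hs
    have he := IsManifold.chart_mem_maximalAtlas (I := 𝓘(ℝ, F)) (n := ∞) (m s)
    have heq : {ζ : E | mfderivWithin 𝓘(ℝ, ℝ) 𝓘(ℝ, F) m (Icc t₀ t₁) s (1 : ℝ)
        = generator (G := G) (E := E) ζ (m s)} =
        (chartGenerator E G (chartAt F (m s)) (chartAt F (m s) (m s)) : E →ₗ[ℝ] F) ⁻¹'
          {derivWithin (chartAt F (m s) ∘ m) (Icc t₀ t₁) s} := by
      ext ζ
      exact (mfderivWithin_eq_generator_iff hm hS he hs (mem_chart_source F (m s)) ζ).trans eq_comm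
    rw [heq]
    exact (convex_singleton _).linear_preimage _
  · intro t htS
    set e := chartAt F (m t) with hedef
    have he : e ∈ IsManifold.maximalAtlas 𝓘(ℝ, F) ∞ M :=
      IsManifold.chart_mem_maximalAtlas (I := 𝓘(ℝ, F)) (n := ∞) (m t)
    obtain ⟨V, hV, hVS⟩ := continuousOn_iff'.1 hm.continuousOn e.source e.open_source
    have hsrc : ∀ s ∈ Icc t₀ t₁ ∩ V, m s ∈ e.source := fun s hs =>
      (hVS.symm.subset ⟨hs.2, hs.1⟩).1
    have htV : t ∈ V := (hVS.subset ⟨mem_chart_source F (m t), htS⟩).1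
    have hy : ∀ s ∈ Icc t₀ t₁ ∩ V, ContDiffWithinAt ℝ ∞ (e ∘ m) (Icc t₀ t₁) s := fun s hs =>
      contDiffWithinAt_chart_curve hm he hs.1 (hsrc s hs)
    have hA : ContDiffOn ℝ ∞ (fun s => chartGenerator E G e (e (m s))) (Icc t₀ t₁ ∩ V) :=
      fun s hs => ContDiffAt.comp_contDiffWithinAt (g := chartGenerator E G e) (f := e ∘ m) s
        (contDiffAt_chartGenerator G he (e.map_source (hsrc s hs)))
        ((hy s hs).mono inter_subset_left)
    have hw : ContDiffOn ℝ ∞ (derivWithin (e ∘ m) (Icc t₀ t₁)) (Icc t₀ t₁ ∩ V) := fun s hs =>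
      (((hy s hs).fderivWithin_right hS (m := ∞) (by simp) hs.1).clm_apply
        (contDiffWithinAt_const (c := (1 : ℝ)))).mono inter_subset_left
    obtain ⟨U, hU, htU, ξ, hξ, hξA⟩ := exists_local_contDiffOn_solution hA hw ⟨htS, htV⟩
      (surjective_chartGenerator he (e.map_source (mem_chart_source F (m t))))
    refine ⟨V ∩ U, hV.inter hU, ⟨htV, htU⟩, ξ, by rwa [← inter_assoc], fun s hs => ?_⟩
    rw [← inter_assoc] at hs
    exact (mfderivWithin_eq_generator_iff hm hS he hs.1.1 (hsrc s hs.1) (ξ s)).2 (hξA s hs).symm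

omit [LieGroup 𝓘(ℝ, E) ∞ G] in
theorem reducedLagrangian_eq_chartLagrangian (L : TangentBundle 𝓘(ℝ, F) M → ℝ)
    (he : e ∈ IsManifold.maximalAtlas 𝓘(ℝ, F) ∞ M) {x : M} (hx : x ∈ e.source)
    (ζ : GroupLieAlgebra 𝓘(ℝ, E) G) :
    reducedLagrangian L ζ x = chartLagrangian L e (e x) (chartGenerator E G e (e x) ζ) := by
  rw [reducedLagrangian, lagrangian_eq_chartLagrangian L he hx]
  exact congrArg _ (mfderiv_generatorMap G he hx ζ)

omit [LieGroup 𝓘(ℝ, E) ∞ G] in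
theorem deltaXi_reducedLagrangian (L : TangentBundle 𝓘(ℝ, F) M → ℝ)
    (he : e ∈ IsManifold.maximalAtlas 𝓘(ℝ, F) ∞ M) {x : M} (hx : x ∈ e.source)
    (ζ : GroupLieAlgebra 𝓘(ℝ, E) G) :
    deltaXi (reducedLagrangian L) ζ x
      = fderiv ℝ (fun ζ : E => chartLagrangian L e (e x) (chartGenerator E G e (e x) ζ)) ζ := by
  have h : (fun ζ : GroupLieAlgebra 𝓘(ℝ, E) G => reducedLagrangian L ζ x)
      = fun ζ => chartLagrangian L e (e x) (chartGenerator E G e (e x) ζ) :=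
    funext fun ζ => reducedLagrangian_eq_chartLagrangian L he hx ζ
  rw [deltaXi, h]
  rfl

/-- The derivative in `z` also sees `z` inside the generator. This is the source of the term
`p(Da(aη) ζ)`. -/
theorem momentumMap_deltaM_reducedLagrangian [IsManifold 𝓘(ℝ, F) ∞ M]
    {L : TangentBundle 𝓘(ℝ, F) M → ℝ}
    (hL : ContMDiff (𝓘(ℝ, F).tangent) 𝓘(ℝ, ℝ) ∞ L)
    (he : e ∈ IsManifold.maximalAtlas 𝓘(ℝ, F) ∞ M) {x : M} (hx : x ∈ e.source)
    (ζ η : GroupLieAlgebra 𝓘(ℝ, E) G) :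
    momentumMap x (deltaM (F := F) (reducedLagrangian L) ζ x) η
      = fderiv ℝ (fun z => chartLagrangian L e z (chartGenerator E G e z ζ)) (e x)
          (chartGenerator E G e (e x) η) := by
  have heq : (fun p : M => reducedLagrangian L ζ p) =ᶠ[𝓝 x]
      fun p => chartLagrangian L e (e p) (chartGenerator E G e (e p) ζ) := by
    filter_upwards [e.open_source.mem_nhds hx] with p hp
    exact reducedLagrangian_eq_chartLagrangian L he hp ζ
  have hd : DifferentiableAt ℝ
      (fun z => chartLagrangian L e z (chartGenerator E G e z ζ)) (e x) := by
    have h1 := (contDiffAt_chartLagrangian hL he (e.map_source hx)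
      (chartGenerator E G e (e x) ζ)).differentiableAt (by simp)
    have h2 := (contDiffAt_chartGenerator (E := E) G he (e.map_source hx)).differentiableAt
      (by simp)
    exact DifferentiableAt.comp (g := fun p : F × F => chartLagrangian L e p.1 p.2) (e x) h1
      (differentiableAt_id.prodMk (h2.clm_apply (differentiableAt_const (ζ : E))))
  have h3 : mfderiv 𝓘(ℝ, F) 𝓘(ℝ, ℝ)
      (fun p : M => chartLagrangian L e (e p) (chartGenerator E G e (e p) ζ)) x
      = (mfderiv 𝓘(ℝ, F) 𝓘(ℝ, ℝ)
          (fun z : F => chartLagrangian L e z (chartGenerator E G e z ζ)) (e x)).comp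
        (mfderiv 𝓘(ℝ, F) 𝓘(ℝ, F) e x) :=
    mfderiv_comp x hd.mdifferentiableAt
      ((mdifferentiable_of_mem_maximalAtlas he).mdifferentiableAt hx)
  have h4 : deltaM (F := F) (reducedLagrangian L) ζ x
      = (fderiv ℝ (fun z => chartLagrangian L e z (chartGenerator E G e z ζ)) (e x)).comp
        (mfderiv 𝓘(ℝ, F) 𝓘(ℝ, F) e x : F →L[ℝ] F) := by
    refine (heq.mfderiv_eq).trans (h3.trans ?_)
    rw [mfderiv_eq_fderiv]
    rfl
  rw [momentumMap, h4]
  exact congrArg _ (mfderiv_generatorMap G he hx η)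

/-- Along a curve generated by `ξ`, the Euler-Poincaré expression is the negative of the
Euler-Lagrange expression in a chart, evaluated at the infinitesimal generators. -/
theorem eulerPoincare_apply_eq_neg_eulerLagrange [FiniteDimensional ℝ E]
    [IsManifold 𝓘(ℝ, F) ∞ M] {L : TangentBundle 𝓘(ℝ, F) M → ℝ}
    (hL : ContMDiff (𝓘(ℝ, F).tangent) 𝓘(ℝ, ℝ) ∞ L) {t₀ t₁ : ℝ} (ht : t₀ < t₁)
    (hm : ContMDiffOn 𝓘(ℝ, ℝ) 𝓘(ℝ, F) ∞ m (Icc t₀ t₁))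
    {ξ : ℝ → GroupLieAlgebra 𝓘(ℝ, E) G} (hξ : IsReconstruction (F := F) t₀ t₁ ξ m)
    (he : e ∈ IsManifold.maximalAtlas 𝓘(ℝ, F) ∞ M) {t : ℝ} (htS : t ∈ Icc t₀ t₁)
    (hmt : m t ∈ e.source) (η : GroupLieAlgebra 𝓘(ℝ, E) G) :
    derivWithin (fun s => deltaXi (reducedLagrangian L) (ξ s) (m s)) (Icc t₀ t₁) t η
        + coadjoint (ξ t) (deltaXi (reducedLagrangian L) (ξ t) (m t)) η
        - momentumMap (m t) (deltaM (F := F) (reducedLagrangian L) (ξ t) (m t)) η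
      = -((fderiv ℝ (fun x : F => chartLagrangian L e x (derivWithin (e ∘ m) (Icc t₀ t₁) t))
            (e (m t))
          - derivWithin (fun s => fderiv ℝ (fun v : F => chartLagrangian L e (e (m s)) v)
              (derivWithin (e ∘ m) (Icc t₀ t₁) s)) (Icc t₀ t₁) t)
          (chartGenerator E G e (e (m t)) η)) := by
  have hS := uniqueDiffOn_Icc ht
  have hyt : e (m t) ∈ e.target := e.map_source hmt
  have hrec : ∀ s ∈ Icc t₀ t₁, m s ∈ e.source →
      derivWithin (e ∘ m) (Icc t₀ t₁) s = chartGenerator E G e (e (m s)) (ξ s) :=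
    fun s hs hms => (mfderivWithin_eq_generator_iff hm hS he hs hms (ξ s)).1 (hξ s hs)
  have hev : ∀ᶠ s in 𝓝[Icc t₀ t₁] t, m s ∈ e.source :=
    (hm t htS).continuousWithinAt.eventually (e.open_source.mem_nhds hmt)
  have hΛ := contDiffAt_chartLagrangian hL he hyt
  have ha := contDiffAt_chartGenerator (E := E) G he hyt
  have hrt := hrec t htS hmt
  have h1 : derivWithin (fun s => deltaXi (reducedLagrangian L) (ξ s) (m s)) (Icc t₀ t₁) t η
      = derivWithin (fun s => fderiv ℝ (fun v : F => chartLagrangian L e (e (m s)) v)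
              (derivWithin (e ∘ m) (Icc t₀ t₁) s)) (Icc t₀ t₁) t (chartGenerator E G e (e (m t)) η)
        + fderiv ℝ (fun v => chartLagrangian L e (e (m t)) v) (derivWithin (e ∘ m) (Icc t₀ t₁) t)
          (fderiv ℝ (chartGenerator E G e) (e (m t)) (derivWithin (e ∘ m) (Icc t₀ t₁) t) η) := by
    have h := derivWithin_fderiv_reduced (y := e ∘ m) (a := chartGenerator E G e) (ξ := ξ)
      hS htS (contDiffWithinAt_chart_curve hm he htS hmt) (hΛ _) ha ?_ η
    · refine Eq.trans ?_ h
      let D : ℝ → E →L[ℝ] ℝ := fun s => deltaXi (reducedLagrangian L) (ξ s) (m s)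
      have heq : D =ᶠ[𝓝[Icc t₀ t₁] t] fun s => fderiv ℝ (fun ζ : E =>
            chartLagrangian L e (e (m s)) (chartGenerator E G e (e (m s)) ζ)) (ξ s : E) := by
        filter_upwards [hev] with s hs
        exact deltaXi_reducedLagrangian L he hs (ξ s)
      exact congrArg (fun T : E →L[ℝ] ℝ => T η) (heq.derivWithin_eq_of_mem htS)
    · filter_upwards [hev, self_mem_nhdsWithin] with s hs hsS
      exact hrec s hsS hs
  have hΛt : DifferentiableAt ℝ (fun p : F × F => chartLagrangian L e p.1 p.2)
      (e (m t), chartGenerator E G e (e (m t)) (ξ t)) := (hΛ _).differentiableAt (by simp)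
  have h2 : coadjoint (ξ t) (deltaXi (reducedLagrangian L) (ξ t) (m t)) η
      = fderiv ℝ (fun v => chartLagrangian L e (e (m t)) v) (derivWithin (e ∘ m) (Icc t₀ t₁) t)
          (chartGenerator E G e (e (m t)) (⁅ξ t, η⁆ : GroupLieAlgebra 𝓘(ℝ, E) G)) := by
    have h : coadjoint (ξ t) (deltaXi (reducedLagrangian L) (ξ t) (m t)) η
        = deltaXi (reducedLagrangian L) (ξ t) (m t) ⁅ξ t, η⁆ := rfl
    rw [h, deltaXi_reducedLagrangian L he hmt, hrt]
    exact fderiv_comp_clm_apply (E := E) (hΛt.comp (chartGenerator E G e (e (m t)) (ξ t))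
        (hasFDerivAt_prodMk_right (e (m t)) _).differentiableAt) _
  have h3 : fderiv ℝ (fun z => chartLagrangian L e z (chartGenerator E G e z (ξ t))) (e (m t))
        (chartGenerator E G e (e (m t)) η)
      = fderiv ℝ (fun z => chartLagrangian L e z (chartGenerator E G e (e (m t)) (ξ t))) (e (m t))
          (chartGenerator E G e (e (m t)) η)
        + fderiv ℝ (fun v => chartLagrangian L e (e (m t)) v) (chartGenerator E G e (e (m t)) (ξ t))
          (fderiv ℝ (chartGenerator E G e) (e (m t)) (chartGenerator E G e (e (m t)) η) (ξ t)) :=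
    fderiv_reduced_base (E := E) hΛt (ha.differentiableAt (by simp)) _
  -- The fibre momentum applied to the antihomomorphism identity: the coadjoint term cancels the
  -- `Da` terms of `h1` and `h3`.
  have h4 := congrArg (fderiv ℝ (fun v => chartLagrangian L e (e (m t)) v)
    (chartGenerator E G e (e (m t)) (ξ t))) (fderiv_chartGenerator_sub he hyt (ξ t) η)
  rw [map_sub] at h4
  rw [hrt] at h1 h2
  rw [hrt, h1, h2, momentumMap_deltaM_reducedLagrangian hL he hmt, h3, ← h4, sub_apply]
  ring

/-- Along a curve generated by `ξ`, the Euler-Poincaré and Euler-Lagrange equations are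
equivalent. -/
theorem satisfiesEulerPoincare_iff_isEulerLagrangeSolution [FiniteDimensional ℝ E]
    [FiniteDimensional ℝ F] [SecondCountableTopology G] [T2Space M] [MulAction.IsPretransitive G M]
    [IsManifold 𝓘(ℝ, F) ∞ M] {L : TangentBundle 𝓘(ℝ, F) M → ℝ}
    (hL : ContMDiff (𝓘(ℝ, F).tangent) 𝓘(ℝ, ℝ) ∞ L) {t₀ t₁ : ℝ} (ht : t₀ < t₁)
    (hm : ContMDiffOn 𝓘(ℝ, ℝ) 𝓘(ℝ, F) ∞ m (Icc t₀ t₁))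
    {ξ : ℝ → GroupLieAlgebra 𝓘(ℝ, E) G} (hξ : IsReconstruction (F := F) t₀ t₁ ξ m) :
    SatisfiesEulerPoincare (F := F) (reducedLagrangian L) t₀ t₁ ξ m
      ↔ IsEulerLagrangeSolution L t₀ t₁ m := by
  constructor
  · intro h e he t htS hmt
    refine ContinuousLinearMap.ext fun w => ?_
    -- Every test vector is a generator, so a covector vanishing on generators is zero.
    obtain ⟨η, rfl⟩ := surjective_chartGenerator (E := E) (G := G) he (e.map_source hmt) w
    have hkey := eulerPoincare_apply_eq_neg_eulerLagrange hL ht hm hξ he htS hmt η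
    exact neg_eq_zero.1 (hkey.symm.trans (sub_eq_zero.2 (DFunLike.congr_fun (h t htS) η)))
  · intro h t htS
    refine ContinuousLinearMap.ext fun η => ?_
    have he := IsManifold.chart_mem_maximalAtlas (I := 𝓘(ℝ, F)) (n := ∞) (m t)
    have hmt := mem_chart_source F (m t)
    have hkey := eulerPoincare_apply_eq_neg_eulerLagrange hL ht hm hξ he htS hmt η
    rw [h _ he t htS hmt, zero_apply, neg_zero, sub_eq_zero] at hkey
    exact hkey

end Main

end EulerPoincare

end

theorem theorem4p1
    {E : Type*} [NormedAddCommGroup E] [NormedSpace ℝ E] [FiniteDimensional ℝ E]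
    {F : Type*} [NormedAddCommGroup F] [NormedSpace ℝ F] [FiniteDimensional ℝ F]
    {G : Type*} [TopologicalSpace G] [ChartedSpace E G] [Group G]
    [LieGroup 𝓘(ℝ, E) ∞ G] [T2Space G] [SecondCountableTopology G]
    {M : Type*} [TopologicalSpace M] [ChartedSpace F M] [IsManifold 𝓘(ℝ, F) ∞ M] [T2Space M]
    [MulAction G M] [ContMDiffSMul 𝓘(ℝ, E) 𝓘(ℝ, F) ∞ G M] [MulAction.IsPretransitive G M]
    (L : TangentBundle 𝓘(ℝ, F) M → ℝ)
    (hL : ContMDiff (𝓘(ℝ, F).tangent) 𝓘(ℝ, ℝ) ∞ L)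
    (t₀ t₁ : ℝ) (ht : t₀ < t₁)
    (m : ℝ → M) (hm : ContMDiffOn 𝓘(ℝ, ℝ) 𝓘(ℝ, F) ∞ m (Set.Icc t₀ t₁)) :
    (EulerPoincare.IsEulerLagrangeSolution L t₀ t₁ m ↔
      ∃ ξ : ℝ → GroupLieAlgebra 𝓘(ℝ, E) G,
        EulerPoincare.IsSmoothLieAlgebraCurve t₀ t₁ ξ ∧
        EulerPoincare.IsReconstruction (F := F) t₀ t₁ ξ m ∧
        EulerPoincare.SatisfiesEulerPoincare (F := F)
          (EulerPoincare.reducedLagrangian L) t₀ t₁ ξ m) ∧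
    (EulerPoincare.IsEulerLagrangeSolution L t₀ t₁ m ↔
      ∀ ξ : ℝ → GroupLieAlgebra 𝓘(ℝ, E) G,
        EulerPoincare.IsSmoothLieAlgebraCurve t₀ t₁ ξ →
        EulerPoincare.IsReconstruction (F := F) t₀ t₁ ξ m →
        EulerPoincare.SatisfiesEulerPoincare (F := F)
          (EulerPoincare.reducedLagrangian L) t₀ t₁ ξ m) := by
  -- `ξ₀` is the witness for the existential form and keeps the universal form from being vacuous.
  obtain ⟨ξ₀, hs₀, hr₀⟩ := EulerPoincare.exists_isReconstruction (E := E) (G := G) ht hm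
  have key := fun (ξ : ℝ → GroupLieAlgebra 𝓘(ℝ, E) G)
      (hξ : EulerPoincare.IsReconstruction (F := F) t₀ t₁ ξ m) =>
    EulerPoincare.satisfiesEulerPoincare_iff_isEulerLagrangeSolution hL ht hm hξ
  exact ⟨⟨fun h => ⟨ξ₀, hs₀, hr₀, (key ξ₀ hr₀).2 h⟩, fun ⟨ξ, _, hr, hep⟩ => (key ξ hr).1 hep⟩,
    ⟨fun h ξ _ hr => (key ξ hr).2 h, fun h => (key ξ₀ hr₀).1 (h ξ₀ hs₀ hr₀)⟩⟩
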